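/- Let $X=(x_i)_{i\in\mathbb Z}$ and $Y=(y_j)_{j\in\mathbb Z}$ be strictly increasing real sequences tending to $\pm\infty$ as the index tends to $\pm\infty$. Put $h_i=x_i-x_{i-1}$, $k_j=y_j-y_{j-1}$, $s_i=\frac12(x_{i-1}+x_i)$, $t_j=\frac12(y_{j-1}+y_j)$, $R_{ij}=[x_{i-1},x_i]\times[y_{j-1},y_j]$, and consider the criss-cross triangulation of $\mathbb R^2$ obtained by drawing both diagonals in each $R_{ij}$. A $C^1$ quadratic spline is a $C^1$ function on $\mathbb R^2$ that coincides on each triangle with a polynomial of total degree at most $2$. Let $\Sigma_{ij}$ be the octagon with vertices $(x_{i-2},y_{j-1})$, $(x_{i-1},y_{j-2})$, $(x_i,y_{j-2})$, $(x_{i+1},y_{j-1})$, $(x_{i+1},y_j)$, $(x_i,y_{j+1})$, $(x_{i-1},y_{j+1})$, $(x_{i-2},y_j)$, and let $B_{ij}$ be the B-spline with support $\Sigma_{ij}$, i.e. the $C^1$ quadratic spline vanishing outside $\Sigma_{ij}$ (such a spline is unique up to a factor), normalized by $B_{ij}(x_i,y_j)=\frac{h_{i+1}}{h_i+h_{i+1}}\,\frac{k_{j+1}}{k_j+k_{j+1}}$.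 The $B_{ij}$ form a partition of unity: $\sum_{i,j}B_{ij}=1$. Let $\tilde\Pi_{ij}=\frac{3}{h_ik_j}\Pi_{ij}$, where $\Pi_{ij}$ is the continuous pyramid with value $1$ at $(s_i,t_j)$ and $0$ outside the interior of $R_{ij}$, affine on each of the four triangles of $R_{ij}$, and let $\tilde\chi_{ij}=\frac{1}{h_ik_j}\chi_{R_{ij}}$. Put $$a_i=\frac{-3h_i^2}{(h_{i-1}+h_i)(3h_{i-1}+4h_i+3h_{i+1})},\quad \bar a_i=\frac{-3h_i^2}{(3h_{i-1}+4h_i+3h_{i+1})(h_i+h_{i+1})},$$ $$\alpha_i=\frac{-h_i^2}{(h_{i-1}+h_i)(h_{i-1}+h_i+h_{i+1})},\quad \bar\alpha_i=\frac{-h_i^2}{(h_{i-1}+h_i+h_{i+1})(h_i+h_{i+1})},$$ let $c_j,\bar c_j,\gamma_j,\bar\gamma_j$ be given by the formulas for $a_j,\bar a_j,\alpha_j,\bar\alpha_j$ with $k$ in place of $h$, and let $b_{ij}=1-(a_i+\bar a_i+c_j+\bar c_j)$, $\beta_{ij}=1-(\alpha_i+\bar\alpha_i+\gamma_j+\bar\gamma_j)$.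 Define the weights $$M_{ij}=a_i\tilde\Pi_{i-1,j}+\bar a_i\tilde\Pi_{i+1,j}+b_{ij}\tilde\Pi_{ij}+c_j\tilde\Pi_{i,j-1}+\bar c_j\tilde\Pi_{i,j+1},$$ $$\psi_{ij}=\alpha_i\tilde\chi_{i-1,j}+\bar\alpha_i\tilde\chi_{i+1,j}+\beta_{ij}\tilde\chi_{ij}+\gamma_j\tilde\chi_{i,j-1}+\bar\gamma_j\tilde\chi_{i,j+1},$$ and, for locally integrable $f$, $$T_2f=\sum_{i,j}\Big(\int_{\mathbb R^2}fM_{ij}\Big)B_{ij},\qquad G_2f=\sum_{i,j}\Big(\int_{\mathbb R^2}f\psi_{ij}\Big)B_{ij}.$$ Then $T_2f$ and $G_2f$ are $C^1$ quadratic splines for every locally integrable $f$; $T_2p=p$ and $G_2p=p$ for every bivariate polynomial $p$ of total degree at most $2$; and $T_2$, $G_2$ are bounded linear operators from $L^\infty(\mathbb R^2)$ to the space of bounded continuous functions on $\mathbb R^2$ with the supremum norm, with operator norms, bounded independently of the partition, $$\Vert T_2\Vert_\infty\le 7,\qquad \Vert G_2\Vert_\infty\le 9.$$ -/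

import Mathlib

open MeasureTheory Filter
open scoped ENNReal BoundedContinuousFunction

namespace CrissCross

noncomputable section

/-! ### The criss-cross triangulation of the plane

The knot sequences `x y : ℤ → ℝ` cut the plane into the rectangles
`[x (i-1), x i] × [y (j-1), y j]`, and every rectangle is cut into four triangles by its two
diagonals. -/

/-- The mesh length `h i = x i - x (i-1)` (and `k j` when applied to `y`). -/
def step (x : ℤ → ℝ) (i : ℤ) : ℝ := x i - x (i - 1)

/-- The midpoint `s i = (x (i-1) + x i) / 2` (and `t j` when applied to `y`). -/
def mid (x : ℤ → ℝ) (i : ℤ) : ℝ := (x (i - 1) + x i) / 2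

/-- The center `ω i j` of the rectangle `R i j`. -/
def center (x y : ℤ → ℝ) (i j : ℤ) : ℝ × ℝ := (mid x i, mid y j)

/-- The closed rectangle `R i j = [x (i-1), x i] × [y (j-1), y j]`. -/
def rect (x y : ℤ → ℝ) (i j : ℤ) : Set (ℝ × ℝ) :=
  Set.Icc (x (i - 1)) (x i) ×ˢ Set.Icc (y (j - 1)) (y j)

/-- The triangles of the triangulation: the convex hulls of the center of a rectangle and of the
two end points of one of its sides (bottom, right, top, left). -/
def IsTriangle (x y : ℤ → ℝ) (τ : Set (ℝ × ℝ)) : Prop :=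
  ∃ i j : ℤ,
    τ = convexHull ℝ {center x y i j, (x (i - 1), y (j - 1)), (x i, y (j - 1))} ∨
    τ = convexHull ℝ {center x y i j, (x i, y (j - 1)), (x i, y j)} ∨
    τ = convexHull ℝ {center x y i j, (x (i - 1), y j), (x i, y j)} ∨
    τ = convexHull ℝ {center x y i j, (x (i - 1), y (j - 1)), (x (i - 1), y j)}

/-- The function on the plane defined by a bivariate polynomial. -/
def polyFun (p : MvPolynomial (Fin 2) ℝ) (z : ℝ × ℝ) : ℝ := MvPolynomial.eval ![z.1, z.2] p

/-- `C¹` quadratic splines on the criss-cross triangulation: continuously differentiable functions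
that coincide on each triangle with a polynomial of total degree at most `2`. -/
def IsC1QuadraticSpline (x y : ℤ → ℝ) (s : ℝ × ℝ → ℝ) : Prop :=
  ContDiff ℝ 1 s ∧ ∀ τ : Set (ℝ × ℝ), IsTriangle x y τ →
    ∃ p : MvPolynomial (Fin 2) ℝ, p.totalDegree ≤ 2 ∧ ∀ z ∈ τ, s z = polyFun p z

/-- The closed octagon `Σ i j` centered around `R i j`: the block of `3 × 3` rectangles around
`R i j`, with its four corner rectangles halved along the diagonal facing `R i j`. -/
def octagon (x y : ℤ → ℝ) (i j : ℤ) : Set (ℝ × ℝ) :=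
  {z | x (i - 2) ≤ z.1 ∧ z.1 ≤ x (i + 1) ∧ y (j - 2) ≤ z.2 ∧ z.2 ≤ y (j + 1) ∧
    1 ≤ (z.1 - x (i - 2)) / step x (i - 1) + (z.2 - y (j - 2)) / step y (j - 1) ∧
    1 ≤ (x (i + 1) - z.1) / step x (i + 1) + (z.2 - y (j - 2)) / step y (j - 1) ∧
    1 ≤ (z.1 - x (i - 2)) / step x (i - 1) + (y (j + 1) - z.2) / step y (j + 1) ∧
    1 ≤ (x (i + 1) - z.1) / step x (i + 1) + (y (j + 1) - z.2) / step y (j + 1)}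

/-! ### The pyramids and the mean-value weights -/

/-- The continuous piecewise affine pyramid on `R i j`, equal to `1` at the center of `R i j` and
to `0` on the boundary and outside of `R i j`, affine on the four triangles of `R i j`. -/
def pyramid (x y : ℤ → ℝ) (i j : ℤ) (z : ℝ × ℝ) : ℝ :=
  max 0 (1 - 2 * max (|z.1 - mid x i| / step x i) (|z.2 - mid y j| / step y j))

/-- The pyramid normalized by its integral `h i * k j / 3`. -/
def pyramidN (x y : ℤ → ℝ) (i j : ℤ) (z : ℝ × ℝ) : ℝ :=
  3 / (step x i * step y j) * pyramid x y i j z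

/-- The normalized characteristic function of `R i j`. -/
def chiN (x y : ℤ → ℝ) (i j : ℤ) (z : ℝ × ℝ) : ℝ :=
  1 / (step x i * step y j) * (rect x y i j).indicator (fun _ => 1) z

/-! ### The B-splines

A `C¹` quadratic spline is described by its Bernstein-Bezier coefficients on the triangles. In each
rectangle these are determined by the coefficients at the four vertices and on the four sides: the
`C¹` conditions across the half-diagonals force the coefficient on the half-diagonal issued from a
vertex to be the mean of the coefficients on the two sides meeting at that vertex, and the
coefficient at the center to be the mean of the coefficients on the four sides. Up to a factor,
there is exactly one choice of the coefficients for which all of them vanish outside the octagon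
and the `C¹` conditions hold across the sides of the rectangles; the factor is chosen so that the
values (and gradients) at the mesh points `(x k, y l)` are those of the tensor product of the usual
normalized univariate quadratic B-splines. With this normalization the `B i j` sum to `1`. -/

/-- The value at the knot `x k` of the univariate quadratic B-spline with knots
`x (i-2), x (i-1), x i, x (i+1)`. -/
def knotVal (x : ℤ → ℝ) (i k : ℤ) : ℝ :=
  if k = i - 1 then step x (i - 1) / (step x (i - 1) + step x i)
  else if k = i then step x (i + 1) / (step x i + step x (i + 1))
  else 0

/-- The middle Bernstein coefficient on `[x (k-1), x k]` of that univariate B-spline. -/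
def midCoef (i k : ℤ) : ℝ := if k = i then 1 else 0

/-- The restriction of the B-spline `B i j` to the rectangle `R k l`, in Bernstein-Bezier form.
Here `p00, p10, p01, p11, q` are the barycentric coordinates with respect to the lower left, lower
right, upper left, upper right vertices and the center, extended by `0` to the triangles that do not
contain the vertex; `v` are the coefficients at the vertices, `eS, eN, eW, eE` those on the bottom,
top, left and right sides. -/
def patch (x y : ℤ → ℝ) (i j k l : ℤ) (z : ℝ × ℝ) : ℝ :=
  let u := (z.1 - x (k - 1)) / step x k
  let w := (z.2 - y (l - 1)) / step y l
  let p00 := max 0 (1 - u - w)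
  let p10 := max 0 (u - w)
  let p01 := max 0 (w - u)
  let p11 := max 0 (u + w - 1)
  let q := pyramid x y k l z
  let v00 := knotVal x i (k - 1) * knotVal y j (l - 1)
  let v10 := knotVal x i k * knotVal y j (l - 1)
  let v01 := knotVal x i (k - 1) * knotVal y j l
  let v11 := knotVal x i k * knotVal y j l
  let eS := midCoef i k * knotVal y j (l - 1)
  let eN := midCoef i k * knotVal y j l
  let eW := knotVal x i (k - 1) * midCoef j l
  let eE := knotVal x i k * midCoef j l
  v00 * p00 ^ 2 + v10 * p10 ^ 2 + v01 * p01 ^ 2 + v11 * p11 ^ 2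
    + 2 * (eS * (p00 * p10) + eE * (p10 * p11) + eN * (p01 * p11) + eW * (p00 * p01))
    + 2 * q * ((eS + eW) / 2 * p00 + (eS + eE) / 2 * p10 + (eN + eW) / 2 * p01
        + (eN + eE) / 2 * p11)
    + (eS + eE + eN + eW) / 4 * q ^ 2

/-- The B-spline `B i j`: the patches on the `3 × 3` rectangles around `R i j`, and `0` elsewhere.
Half-open rectangles are used so that every point lies in just one of them. -/
def bspline (x y : ℤ → ℝ) (i j : ℤ) (z : ℝ × ℝ) : ℝ :=
  ∑ k ∈ Finset.Icc (i - 1) (i + 1), ∑ l ∈ Finset.Icc (j - 1) (j + 1),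
    (Set.Ico (x (k - 1)) (x k) ×ˢ Set.Ico (y (l - 1)) (y l)).indicator (patch x y i j k l) z

/-! ### The quasi-interpolants -/

/-- The coefficient `a i` (and `c j` when applied to `y`). -/
def a (x : ℤ → ℝ) (i : ℤ) : ℝ :=
  -3 * step x i ^ 2 /
    ((step x (i - 1) + step x i) * (3 * step x (i - 1) + 4 * step x i + 3 * step x (i + 1)))

/-- The coefficient `a-bar i` (and `c-bar j` when applied to `y`). -/
def aBar (x : ℤ → ℝ) (i : ℤ) : ℝ :=
  -3 * step x i ^ 2 /
    ((3 * step x (i - 1) + 4 * step x i + 3 * step x (i + 1)) * (step x i + step x (i + 1)))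

/-- The coefficient `α i` (and `γ j` when applied to `y`). -/
def alpha (x : ℤ → ℝ) (i : ℤ) : ℝ :=
  -step x i ^ 2 /
    ((step x (i - 1) + step x i) * (step x (i - 1) + step x i + step x (i + 1)))

/-- The coefficient `α-bar i` (and `γ-bar j` when applied to `y`). -/
def alphaBar (x : ℤ → ℝ) (i : ℤ) : ℝ :=
  -step x i ^ 2 /
    ((step x (i - 1) + step x i + step x (i + 1)) * (step x i + step x (i + 1)))

/-- The coefficient `b i j`. -/
def b (x y : ℤ → ℝ) (i j : ℤ) : ℝ := 1 - (a x i + aBar x i + a y j + aBar y j)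

/-- The coefficient `β i j`. -/
def beta (x y : ℤ → ℝ) (i j : ℤ) : ℝ := 1 - (alpha x i + alphaBar x i + alpha y j + alphaBar y j)

/-- The pyramid weight `M i j`. -/
def M (x y : ℤ → ℝ) (i j : ℤ) (z : ℝ × ℝ) : ℝ :=
  a x i * pyramidN x y (i - 1) j z + aBar x i * pyramidN x y (i + 1) j z
    + b x y i j * pyramidN x y i j z
    + a y j * pyramidN x y i (j - 1) z + aBar y j * pyramidN x y i (j + 1) z

/-- The mean-value weight `ψ i j`. -/
def psi (x y : ℤ → ℝ) (i j : ℤ) (z : ℝ × ℝ) : ℝ :=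
  alpha x i * chiN x y (i - 1) j z + alphaBar x i * chiN x y (i + 1) j z
    + beta x y i j * chiN x y i j z
    + alpha y j * chiN x y i (j - 1) z + alphaBar y j * chiN x y i (j + 1) z

/-- The quasi-interpolant `T₂ f = ∑ ⟨f, M i j⟩ B i j`. The sum has finitely many nonzero terms at
each point. -/
def T2 (x y : ℤ → ℝ) (f : ℝ × ℝ → ℝ) (z : ℝ × ℝ) : ℝ :=
  ∑' ij : ℤ × ℤ, (∫ v : ℝ × ℝ, f v * M x y ij.1 ij.2 v) * bspline x y ij.1 ij.2 z

/-- The quasi-interpolant `G₂ f = ∑ ⟨f, ψ i j⟩ B i j`. The sum has finitely many nonzero terms at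
each point. -/
def G2 (x y : ℤ → ℝ) (f : ℝ × ℝ → ℝ) (z : ℝ × ℝ) : ℝ :=
  ∑' ij : ℤ × ℤ, (∫ v : ℝ × ℝ, f v * psi x y ij.1 ij.2 v) * bspline x y ij.1 ij.2 z

end

end CrissCross

namespace CrissCross

/-! ### Knot sequences and gluing over the rectangles -/

/-! A spline is encoded by its Bernstein-Bezier coefficients at the mesh points and on the sides of
the rectangles (`Net`). Inside a rectangle the piece is a polynomial plus squares of truncated
linear forms, so it is C¹ across the diagonals by itself. Across a side, the C¹ conditions reduce to
equalities of slopes at its end points (`Net.Smooth`, `contDiff_glue`).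

The net of a combination of B-splines with coefficients `c` is obtained by averaging `c` at the
knots in each direction (`sum_mul_piece`). These averages have matching slopes, so every
combination, in particular every `T2 f` and `G2 f`, is a C¹ quadratic spline. Taking for `c` the
polar forms of a quadratic polynomial reproduces that polynomial (`tsum_mul_bspline_quadratic`); the
constant 1 gives the partition of unity.

For exactness it remains to see that the weights send a quadratic polynomial to its B-spline
coefficients. The mean of a quadratic over one rectangle, against a symmetric kernel of variance σ
(1/20 for pyramids, 1/12 for boxes), equals the value at the center plus σ times squared steps. The
five-point stencil corrects this to the polar form exactly when two moment conditions hold in each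
direction (`IsExact`, `IsMeanWeight.integral_stencil`).

For the norms, the B-splines are nonnegative and sum to 1, so the operator norm is at most the
largest L¹ norm of a weight. That is at most `1 + 8 * r` if the outer stencil coefficients are at
most `r` in absolute value; here `r` is 3/4 or 1. -/

/-- Strictly increasing knot sequences that are unbounded in both directions. -/
structure IsKnots (x : ℤ → ℝ) : Prop where
  strictMono : StrictMono x
  tendsto_top : Tendsto x atTop atTop
  tendsto_bot : Tendsto x atBot atBot

theorem IsKnots.step_pos {x : ℤ → ℝ} (hx : IsKnots x) (i : ℤ) : 0 < step x i :=
  sub_pos.2 (hx.strictMono (by omega))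

theorem IsKnots.exists_index {x : ℤ → ℝ} (hx : IsKnots x) (t : ℝ) :
    ∃ k : ℤ, x (k - 1) ≤ t ∧ t < x k := by
  obtain ⟨b, hb⟩ := (hx.tendsto_bot.eventually (eventually_le_atBot t)).exists
  obtain ⟨c, hc⟩ := (hx.tendsto_top.eventually (eventually_gt_atTop t)).exists
  obtain ⟨k, hk, hmin⟩ := Int.exists_least_of_bdd (P := fun k => t < x k)
    ⟨b, fun z hz => (hx.strictMono.lt_iff_lt.1 (hb.trans_lt hz)).le⟩ ⟨c, hc⟩
  refine ⟨k, ?_, hk⟩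
  by_contra! h
  have := hmin _ h
  omega

/-- The index `k` of the mesh interval `[x (k-1), x k)` that contains `t`. -/
noncomputable def knotIndex (x : ℤ → ℝ) (t : ℝ) : ℤ :=
  Classical.epsilon fun k => x (k - 1) ≤ t ∧ t < x k

theorem IsKnots.index_le {x : ℤ → ℝ} (hx : IsKnots x) (t : ℝ) : x (knotIndex x t - 1) ≤ t :=
  (Classical.epsilon_spec (hx.exists_index t)).1

theorem IsKnots.lt_index {x : ℤ → ℝ} (hx : IsKnots x) (t : ℝ) : t < x (knotIndex x t) :=
  (Classical.epsilon_spec (hx.exists_index t)).2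

theorem IsKnots.index_eq {x : ℤ → ℝ} (hx : IsKnots x) {t : ℝ} {k : ℤ} (h₁ : x (k - 1) ≤ t)
    (h₂ : t < x k) : knotIndex x t = k := by
  have h₃ := hx.strictMono.lt_iff_lt.1 ((hx.index_le t).trans_lt h₂)
  have h₄ := hx.strictMono.lt_iff_lt.1 (h₁.trans_lt (hx.lt_index t))
  omega

/-- The mesh intervals are closed on the left only, so the right end of a closed interval belongs to
the next one. -/
theorem IsKnots.eq_index_or {x : ℤ → ℝ} (hx : IsKnots x) {t : ℝ} {k : ℤ} (h₁ : x (k - 1) ≤ t)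
    (h₂ : t ≤ x k) : knotIndex x t = k ∨ (knotIndex x t = k + 1 ∧ t = x k) := by
  rcases h₂.lt_or_eq with h | h
  · exact Or.inl (hx.index_eq h₁ h)
  · refine Or.inr ⟨hx.index_eq (by simp [h]) ?_, h⟩
    rw [h]
    exact hx.strictMono (by omega)

/-- The function equal to `F k l` on the half-open rectangle with indices `k`, `l`. -/
noncomputable def glue (x y : ℤ → ℝ) (F : ℤ → ℤ → ℝ × ℝ → ℝ) (z : ℝ × ℝ) : ℝ :=
  F (knotIndex x z.1) (knotIndex y z.2) z

/-- The functions of the family agree on the common sides of neighbouring rectangles. -/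
structure Matches (x y : ℤ → ℝ) (F : ℤ → ℤ → ℝ × ℝ → ℝ) : Prop where
  horizontal : ∀ k l : ℤ, ∀ t ∈ Set.Icc (y (l - 1)) (y l), F k l (x k, t) = F (k + 1) l (x k, t)
  vertical : ∀ k l : ℤ, ∀ t ∈ Set.Icc (x (k - 1)) (x k), F k l (t, y l) = F k (l + 1) (t, y l)

section Gluing

variable {x y : ℤ → ℝ} {F : ℤ → ℤ → ℝ × ℝ → ℝ}

theorem Matches.glue_eq (hF : Matches x y F) (hx : IsKnots x) (hy : IsKnots y) {k l : ℤ}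
    {z : ℝ × ℝ} (hz : z ∈ rect x y k l) : glue x y F z = F k l z := by
  obtain ⟨s, t⟩ := z
  obtain ⟨⟨h₁, h₂⟩, h₃, h₄⟩ := hz
  dsimp only at h₁ h₂ h₃ h₄
  unfold glue
  dsimp only
  rcases hx.eq_index_or h₁ h₂ with h | ⟨h, hs⟩ <;> rcases hy.eq_index_or h₃ h₄ with h' | ⟨h', ht⟩
  · rw [h, h']
  · rw [h, h', ht, hF.vertical k l s ⟨h₁, h₂⟩]
  · rw [h, h', hs, hF.horizontal k l t ⟨h₃, h₄⟩]
  -- At the upper right corner two sides are crossed in turn, through the rectangle with indices `k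
  -- + 1`, `l`.
  · have h₅ : x (k + 1 - 1) ≤ s := by simp [hs]
    have h₆ : s ≤ x (k + 1) := hs.le.trans (hx.strictMono.monotone (by omega))
    rw [h, h', ht, ← hF.vertical (k + 1) l s ⟨h₅, h₆⟩, hs,
      ← hF.horizontal k l (y l) ⟨hy.strictMono.monotone (by omega), le_rfl⟩]

theorem isClosed_rect (x y : ℤ → ℝ) (k l : ℤ) : IsClosed (rect x y k l) :=
  isClosed_Icc.prod isClosed_Icc

theorem mem_rect_index (hx : IsKnots x) (hy : IsKnots y) (z : ℝ × ℝ) :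
    z ∈ rect x y (knotIndex x z.1) (knotIndex y z.2) :=
  ⟨⟨hx.index_le _, (hx.lt_index _).le⟩, hy.index_le _, (hy.lt_index _).le⟩

/-- An open rectangle around `z` that meets few mesh rectangles. -/
def window (x y : ℤ → ℝ) (k l : ℤ) : Set (ℝ × ℝ) :=
  Set.Ioo (x (k - 2)) (x k) ×ˢ Set.Ioo (y (l - 2)) (y l)

theorem isOpen_window (x y : ℤ → ℝ) (k l : ℤ) : IsOpen (window x y k l) :=
  isOpen_Ioo.prod isOpen_Ioo

theorem mem_window_index (hx : IsKnots x) (hy : IsKnots y) (z : ℝ × ℝ) :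
    z ∈ window x y (knotIndex x z.1) (knotIndex y z.2) :=
  ⟨⟨(hx.strictMono (by omega)).trans_le (hx.index_le _), hx.lt_index _⟩,
    (hy.strictMono (by omega)).trans_le (hy.index_le _), hy.lt_index _⟩

/-- A point of a half-open rectangle may lie on its left or bottom side but never on the right or
top one. Enlarging to the left and below therefore gives a neighbourhood covered by only four mesh
rectangles. -/
theorem index_of_mem_Ioo (hx : IsKnots x) {k : ℤ} {t : ℝ} (ht : t ∈ Set.Ioo (x (k - 2)) (x k)) :
    knotIndex x t = k - 1 ∨ knotIndex x t = k := by
  have h₁ := hx.strictMono.lt_iff_lt.1 (ht.1.trans (hx.lt_index t))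
  have h₂ := hx.strictMono.lt_iff_lt.1 ((hx.index_le t).trans_lt ht.2)
  omega

theorem locallyFinite_rect (hx : IsKnots x) (hy : IsKnots y) :
    LocallyFinite fun kl : ℤ × ℤ => rect x y kl.1 kl.2 := by
  intro z
  set k := knotIndex x z.1
  set l := knotIndex y z.2
  refine ⟨_, (isOpen_window x y k l).mem_nhds (mem_window_index hx hy z), ?_⟩
  refine ((Set.finite_Icc (k - 2) k).prod (Set.finite_Icc (l - 2) l)).subset ?_
  rintro ⟨i, j⟩ ⟨w, ⟨⟨h₁, h₂⟩, h₃, h₄⟩, ⟨h₅, h₆⟩, h₇, h₈⟩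
  have e₁ := hx.strictMono.lt_iff_lt.1 (h₁.trans_lt h₆)
  have e₂ := hx.strictMono.lt_iff_lt.1 (h₅.trans_le h₂)
  have e₃ := hy.strictMono.lt_iff_lt.1 (h₃.trans_lt h₈)
  have e₄ := hy.strictMono.lt_iff_lt.1 (h₇.trans_le h₄)
  refine ⟨⟨?_, ?_⟩, ?_, ?_⟩ <;> dsimp only <;> omega

theorem Matches.continuous_glue (hF : Matches x y F) (hx : IsKnots x) (hy : IsKnots y)
    (hc : ∀ k l, Continuous (F k l)) : Continuous (glue x y F) := by
  refine (locallyFinite_rect hx hy).continuous ?_ (fun _ => isClosed_rect x y _ _) fun kl =>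
    (hc kl.1 kl.2).continuousOn.congr fun z hz => hF.glue_eq hx hy hz
  exact Set.eq_univ_of_forall fun z => Set.mem_iUnion.2
    ⟨(knotIndex x z.1, knotIndex y z.2), mem_rect_index hx hy z⟩

/-- The linear form with the given partial derivatives. -/
noncomputable def gradForm (p q : ℝ) : ℝ × ℝ →L[ℝ] ℝ :=
  p • ContinuousLinearMap.fst ℝ ℝ ℝ + q • ContinuousLinearMap.snd ℝ ℝ ℝ

/-- On each closed rectangle through a point the glued function has a derivative within that
rectangle, and the matching of the partial derivatives makes all these derivatives the same.
Finitely many such rectangles cover a neighbourhood, so they combine to a full derivative, which is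
continuous because the glued partial derivatives are. -/
theorem contDiff_glue {Fu Fw : ℤ → ℤ → ℝ × ℝ → ℝ} (hx : IsKnots x) (hy : IsKnots y)
    (hF : Matches x y F) (hFu : Matches x y Fu) (hFw : Matches x y Fw)
    (hcu : ∀ k l, Continuous (Fu k l)) (hcw : ∀ k l, Continuous (Fw k l))
    (hd : ∀ k l z, HasFDerivAt (F k l) (gradForm (Fu k l z) (Fw k l z)) z) :
    ContDiff ℝ 1 (glue x y F) := by
  rw [contDiff_one_iff_hasFDerivAt]
  refine ⟨fun z => gradForm (glue x y Fu z) (glue x y Fw z), ?_, fun z => ?_⟩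
  · have h₁ := hFu.continuous_glue hx hy hcu
    have h₂ := hFw.continuous_glue hx hy hcw
    unfold gradForm
    fun_prop
  · have key : ∀ k l, HasFDerivWithinAt (glue x y F)
        (gradForm (glue x y Fu z) (glue x y Fw z)) (rect x y k l) z := by
      intro k l
      by_cases hz : z ∈ rect x y k l
      · rw [hFu.glue_eq hx hy hz, hFw.glue_eq hx hy hz]
        exact (hd k l z).hasFDerivWithinAt.congr (fun w hw => hF.glue_eq hx hy hw)
          (hF.glue_eq hx hy hz)
      -- Away from a closed rectangle, differentiability within it is vacuous.
      · exact .of_notMem_closure (by rwa [(isClosed_rect x y k l).closure_eq])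
    set k := knotIndex x z.1
    set l := knotIndex y z.2
    refine (((key (k - 1) (l - 1)).union (key (k - 1) l)).union
      ((key k (l - 1)).union (key k l))).hasFDerivAt (mem_of_superset
        ((isOpen_window x y k l).mem_nhds (mem_window_index hx hy z)) fun w hw => ?_)
    have hm := mem_rect_index hx hy w
    rcases index_of_mem_Ioo hx hw.1 with h | h <;> rcases index_of_mem_Ioo hy hw.2 with h' | h' <;>
      rw [h, h'] at hm
    · exact Or.inl (Or.inl hm)
    · exact Or.inl (Or.inr hm)
    · exact Or.inr (Or.inl hm)
    · exact Or.inr (Or.inr hm)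

end Gluing

/-! ### The pieces of a spline with given Bernstein-Bezier coefficients -/

/-- The quadratic spline on the square `[0,1]²`, cut by its diagonals, with coefficients `v` at the
vertices and `eS`, `eN`, `eW`, `eE` on the sides. It is written with truncated powers, and so is
defined and continuously differentiable on the whole plane. -/
noncomputable def bezier (v00 v10 v01 v11 eS eN eW eE u w : ℝ) : ℝ :=
  -- The untruncated terms form the polynomial of the left triangle, where both truncated squares
  -- vanish; the factors of these squares are the second order jumps across the two diagonals.
  v00 * (1 - u - w) ^ 2 + v01 * (w - u) ^ 2 + 2 * eW * ((1 - u - w) * (w - u))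
    + 2 * u * ((eS + eW) * (1 - u - w) + (eN + eW) * (w - u)) + (eS + eE + eN + eW) * u ^ 2
    + (v10 - v01 + eN + eW - eS - eE) * max 0 (u - w) ^ 2
    + (v11 - v00 + eS + eW - eN - eE) * max 0 (u + w - 1) ^ 2

/-- The partial derivative of `bezier` with respect to the first coordinate. -/
noncomputable def bezierU (v00 v10 v01 v11 eS eN eW eE u w : ℝ) : ℝ :=
  -2 * v00 * (1 - u - w) - 2 * v01 * (w - u) - 2 * eW * (1 - 2 * u)
    + 2 * ((eS + eW) * (1 - u - w) + (eN + eW) * (w - u)) - 2 * u * (eS + eN + 2 * eW)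
    + 2 * (eS + eE + eN + eW) * u
    + 2 * (v10 - v01 + eN + eW - eS - eE) * max 0 (u - w)
    + 2 * (v11 - v00 + eS + eW - eN - eE) * max 0 (u + w - 1)

/-- The partial derivative of `bezier` with respect to the second coordinate. -/
noncomputable def bezierW (v00 v10 v01 v11 eS eN eW eE u w : ℝ) : ℝ :=
  -2 * v00 * (1 - u - w) + 2 * v01 * (w - u) + 2 * eW * (1 - 2 * w) + 2 * u * (eN - eS)
    - 2 * (v10 - v01 + eN + eW - eS - eE) * max 0 (u - w)
    + 2 * (v11 - v00 + eS + eW - eN - eE) * max 0 (u + w - 1)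

/-- At the break point the function is O(s²), hence has derivative 0 there. This is what makes
`bezier` differentiable across the diagonals. -/
theorem hasDerivAt_max_zero_sq (t : ℝ) :
    HasDerivAt (fun s : ℝ => max 0 s ^ 2) (2 * max 0 t) t := by
  rcases lt_trichotomy t 0 with h | rfl | h
  · rw [max_eq_left h.le, mul_zero]
    refine (hasDerivAt_const t (0 : ℝ)).congr_of_eventuallyEq ?_
    filter_upwards [Iio_mem_nhds h] with s hs
    simp [max_eq_left (Set.mem_Iio.1 hs).le]
  · rw [max_self, mul_zero]
    have h : (fun s : ℝ => max 0 s ^ 2) =O[nhds 0] fun s => ‖s - 0‖ ^ 2 := by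
      refine Asymptotics.IsBigO.of_bound 1 (Eventually.of_forall fun s => ?_)
      rw [one_mul, sub_zero, norm_pow, norm_pow, norm_norm]
      refine pow_le_pow_left₀ (norm_nonneg _) ?_ 2
      rcases le_total 0 s with h | h <;> simp [h]
    simpa using (h.hasFDerivAt one_lt_two).hasDerivAt
  · rw [max_eq_right h.le]
    have h₁ : HasDerivAt (fun s : ℝ => s ^ 2) (2 * t) t := by simpa using hasDerivAt_pow 2 t
    refine h₁.congr_of_eventuallyEq ?_
    filter_upwards [Ioi_mem_nhds h] with s hs
    simp [max_eq_right (Set.mem_Ioi.1 hs).le]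

theorem hasFDerivAt_bezier (v00 v10 v01 v11 eS eN eW eE : ℝ) (z : ℝ × ℝ) :
    HasFDerivAt (fun z : ℝ × ℝ => bezier v00 v10 v01 v11 eS eN eW eE z.1 z.2)
      (gradForm (bezierU v00 v10 v01 v11 eS eN eW eE z.1 z.2)
        (bezierW v00 v10 v01 v11 eS eN eW eE z.1 z.2)) z := by
  have hu : HasFDerivAt (fun z : ℝ × ℝ => z.1) (ContinuousLinearMap.fst ℝ ℝ ℝ) z := hasFDerivAt_fst
  have hw : HasFDerivAt (fun z : ℝ × ℝ => z.2) (ContinuousLinearMap.snd ℝ ℝ ℝ) z := hasFDerivAt_snd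
  have h₀ := (hu.const_sub 1).sub hw
  have h₁ := hw.sub hu
  have hA := (hasDerivAt_max_zero_sq (z.1 - z.2)).comp_hasFDerivAt z (hu.sub hw)
  have hB := (hasDerivAt_max_zero_sq (z.1 + z.2 - 1)).comp_hasFDerivAt z ((hu.add hw).sub_const 1)
  have := (((((((h₀.pow 2).const_mul v00).add ((h₁.pow 2).const_mul v01)).add
    ((h₀.mul h₁).const_mul (2 * eW))).add ((hu.const_mul 2).mul
      ((h₀.const_mul (eS + eW)).add (h₁.const_mul (eN + eW))))).add
        ((hu.pow 2).const_mul (eS + eE + eN + eW))).add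
          (hA.const_mul (v10 - v01 + eN + eW - eS - eE))).add
            (hB.const_mul (v11 - v00 + eS + eW - eN - eE))
  refine (this.congr_fderiv ?_)
  ext <;> simp [gradForm, bezierU, bezierW] <;> ring

/-- The Bernstein-Bezier coefficients at the mesh points, at the horizontal and at the vertical
sides of the rectangles. -/
abbrev Net : Type := (ℤ → ℤ → ℝ) × (ℤ → ℤ → ℝ) × (ℤ → ℤ → ℝ)

/-- The local coordinate on `[x (k-1), x k]`. -/
noncomputable def coord (x : ℤ → ℝ) (k : ℤ) (t : ℝ) : ℝ := (t - x (k - 1)) / step x k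

/-- Apply a function of the local coefficients and coordinates on the rectangle `k l`. -/
noncomputable def Net.local (x y : ℤ → ℝ) (B : ℝ → ℝ → ℝ → ℝ → ℝ → ℝ → ℝ → ℝ → ℝ → ℝ → ℝ) (N : Net) (k l : ℤ)
    (z : ℝ × ℝ) : ℝ :=
  B (N.1 (k - 1) (l - 1)) (N.1 k (l - 1)) (N.1 (k - 1) l) (N.1 k l) (N.2.1 k (l - 1)) (N.2.1 k l)
    (N.2.2 (k - 1) l) (N.2.2 k l) (coord x k z.1) (coord y l z.2)

/-- The piece on the rectangle `k l` of the spline with coefficients `N`. -/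
noncomputable def piece (x y : ℤ → ℝ) (N : Net) (k l : ℤ) (z : ℝ × ℝ) : ℝ :=
  N.local x y bezier k l z

/-- The conditions for continuous differentiability across the mesh lines. -/
structure Net.Smooth (x y : ℤ → ℝ) (N : Net) : Prop where
  horizontal : ∀ k l, (N.1 k l - N.2.1 k l) / step x k = (N.2.1 (k + 1) l - N.1 k l) / step x (k + 1)
  vertical : ∀ k l, (N.1 k l - N.2.2 k l) / step y l = (N.2.2 k (l + 1) - N.1 k l) / step y (l + 1)

theorem coord_right {x : ℤ → ℝ} (hx : IsKnots x) (k : ℤ) : coord x k (x k) = 1 :=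
  div_self (hx.step_pos k).ne'

theorem coord_left (x : ℤ → ℝ) (k : ℤ) : coord x (k + 1) (x k) = 0 := by
  simp [coord]

theorem coord_mem {x : ℤ → ℝ} (hx : IsKnots x) {k : ℤ} {t : ℝ}
    (ht : t ∈ Set.Icc (x (k - 1)) (x k)) : 0 ≤ coord x k t ∧ coord x k t ≤ 1 := by
  have h := hx.step_pos k
  have h' : step x k = x k - x (k - 1) := rfl
  exact ⟨div_nonneg (by linarith [ht.1]) h.le, (div_le_one h).2 (by linarith [ht.2])⟩

theorem coord_spec {x : ℤ → ℝ} (hx : IsKnots x) (k : ℤ) (t : ℝ) :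
    t = x (k - 1) + coord x k t * step x k := by
  rw [coord, div_mul_cancel₀ _ (hx.step_pos k).ne']
  ring

/-! ### Values and gradients on the sides of the unit square -/

section Sides

variable (v00 v10 v01 v11 eS eN eW eE : ℝ) {t : ℝ} (h₀ : 0 ≤ t) (h₁ : t ≤ 1)
include h₀ h₁

/-- On a side, the value and the tangential derivative involve only the three coefficients of that
side, and the normal derivative is affine between its values at the two ends. Hence matching across
a side reduces to conditions at mesh points. -/
theorem bezier_one_left : bezier v00 v10 v01 v11 eS eN eW eE 1 t
    = v10 * (1 - t) ^ 2 + 2 * eE * (t * (1 - t)) + v11 * t ^ 2 := by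
  rw [bezier, max_eq_right (by linarith : 0 ≤ 1 - t), max_eq_right (by linarith : 0 ≤ 1 + t - 1)]
  ring

theorem bezierU_one_left : bezierU v00 v10 v01 v11 eS eN eW eE 1 t
    = 2 * ((v10 - eS) * (1 - t) + (v11 - eN) * t) := by
  rw [bezierU, max_eq_right (by linarith : 0 ≤ 1 - t), max_eq_right (by linarith : 0 ≤ 1 + t - 1)]
  ring

theorem bezierW_one_left : bezierW v00 v10 v01 v11 eS eN eW eE 1 t
    = 2 * ((eE - v10) * (1 - t) + (v11 - eE) * t) := by
  rw [bezierW, max_eq_right (by linarith : 0 ≤ 1 - t), max_eq_right (by linarith : 0 ≤ 1 + t - 1)]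
  ring

theorem bezier_zero_left : bezier v00 v10 v01 v11 eS eN eW eE 0 t
    = v00 * (1 - t) ^ 2 + 2 * eW * (t * (1 - t)) + v01 * t ^ 2 := by
  rw [bezier, max_eq_left (by linarith : 0 - t ≤ 0), max_eq_left (by linarith : 0 + t - 1 ≤ 0)]
  ring

theorem bezierU_zero_left : bezierU v00 v10 v01 v11 eS eN eW eE 0 t
    = 2 * ((eS - v00) * (1 - t) + (eN - v01) * t) := by
  rw [bezierU, max_eq_left (by linarith : 0 - t ≤ 0), max_eq_left (by linarith : 0 + t - 1 ≤ 0)]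
  ring

theorem bezierW_zero_left : bezierW v00 v10 v01 v11 eS eN eW eE 0 t
    = 2 * ((eW - v00) * (1 - t) + (v01 - eW) * t) := by
  rw [bezierW, max_eq_left (by linarith : 0 - t ≤ 0), max_eq_left (by linarith : 0 + t - 1 ≤ 0)]
  ring

theorem bezier_one_right : bezier v00 v10 v01 v11 eS eN eW eE t 1
    = v01 * (1 - t) ^ 2 + 2 * eN * (t * (1 - t)) + v11 * t ^ 2 := by
  rw [bezier, max_eq_left (by linarith : t - 1 ≤ 0), max_eq_right (by linarith : 0 ≤ t + 1 - 1)]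
  ring

theorem bezierU_one_right : bezierU v00 v10 v01 v11 eS eN eW eE t 1
    = 2 * ((eN - v01) * (1 - t) + (v11 - eN) * t) := by
  rw [bezierU, max_eq_left (by linarith : t - 1 ≤ 0), max_eq_right (by linarith : 0 ≤ t + 1 - 1)]
  ring

theorem bezierW_one_right : bezierW v00 v10 v01 v11 eS eN eW eE t 1
    = 2 * ((v01 - eW) * (1 - t) + (v11 - eE) * t) := by
  rw [bezierW, max_eq_left (by linarith : t - 1 ≤ 0), max_eq_right (by linarith : 0 ≤ t + 1 - 1)]
  ring

theorem bezier_zero_right : bezier v00 v10 v01 v11 eS eN eW eE t 0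
    = v00 * (1 - t) ^ 2 + 2 * eS * (t * (1 - t)) + v10 * t ^ 2 := by
  rw [bezier, max_eq_right (by linarith : 0 ≤ t - 0), max_eq_left (by linarith : t + 0 - 1 ≤ 0)]
  ring

theorem bezierU_zero_right : bezierU v00 v10 v01 v11 eS eN eW eE t 0
    = 2 * ((eS - v00) * (1 - t) + (v10 - eS) * t) := by
  rw [bezierU, max_eq_right (by linarith : 0 ≤ t - 0), max_eq_left (by linarith : t + 0 - 1 ≤ 0)]
  ring

theorem bezierW_zero_right : bezierW v00 v10 v01 v11 eS eN eW eE t 0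
    = 2 * ((eW - v00) * (1 - t) + (eE - v10) * t) := by
  rw [bezierW, max_eq_right (by linarith : 0 ≤ t - 0), max_eq_left (by linarith : t + 0 - 1 ≤ 0)]
  ring

end Sides

/-! ### Smoothness of the glued pieces -/

section Smooth

variable {x y : ℤ → ℝ} {N : Net}

theorem matches_piece (hx : IsKnots x) (hy : IsKnots y) : Matches x y (piece x y N) where
  horizontal k l t ht := by
    obtain ⟨h₀, h₁⟩ := coord_mem hy ht
    simp only [piece, Net.local, coord_right hx, coord_left, bezier_one_left _ _ _ _ _ _ _ _ h₀ h₁,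
      bezier_zero_left _ _ _ _ _ _ _ _ h₀ h₁, add_sub_cancel_right]
  vertical k l t ht := by
    obtain ⟨h₀, h₁⟩ := coord_mem hx ht
    simp only [piece, Net.local, coord_right hy, coord_left, bezier_one_right _ _ _ _ _ _ _ _ h₀ h₁,
      bezier_zero_right _ _ _ _ _ _ _ _ h₀ h₁, add_sub_cancel_right]

theorem matches_pieceU (hx : IsKnots x) (hy : IsKnots y) (hN : N.Smooth x y) :
    Matches x y fun k l z => N.local x y bezierU k l z / step x k where
  horizontal k l t ht := by
    obtain ⟨h₀, h₁⟩ := coord_mem hy ht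
    simp only [Net.local, coord_right hx, coord_left, bezierU_one_left _ _ _ _ _ _ _ _ h₀ h₁,
      bezierU_zero_left _ _ _ _ _ _ _ _ h₀ h₁, add_sub_cancel_right]
    -- The normal derivative is affine along the side, so the conditions at the two ends are
    -- combined with weights `1 - t` and `t` in the local coordinate.
    linear_combination 2 * (1 - coord y l t) * hN.horizontal k (l - 1)
      + 2 * coord y l t * hN.horizontal k l
  vertical k l t ht := by
    obtain ⟨h₀, h₁⟩ := coord_mem hx ht
    simp only [Net.local, coord_right hy, coord_left, bezierU_one_right _ _ _ _ _ _ _ _ h₀ h₁,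
      bezierU_zero_right _ _ _ _ _ _ _ _ h₀ h₁, add_sub_cancel_right]

theorem matches_pieceW (hx : IsKnots x) (hy : IsKnots y) (hN : N.Smooth x y) :
    Matches x y fun k l z => N.local x y bezierW k l z / step y l where
  horizontal k l t ht := by
    obtain ⟨h₀, h₁⟩ := coord_mem hy ht
    simp only [Net.local, coord_right hx, coord_left, bezierW_one_left _ _ _ _ _ _ _ _ h₀ h₁,
      bezierW_zero_left _ _ _ _ _ _ _ _ h₀ h₁, add_sub_cancel_right]
  vertical k l t ht := by
    obtain ⟨h₀, h₁⟩ := coord_mem hx ht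
    simp only [Net.local, coord_right hy, coord_left, bezierW_one_right _ _ _ _ _ _ _ _ h₀ h₁,
      bezierW_zero_right _ _ _ _ _ _ _ _ h₀ h₁, add_sub_cancel_right]
    linear_combination 2 * (1 - coord x k t) * hN.vertical (k - 1) l
      + 2 * coord x k t * hN.vertical k l

theorem hasFDerivAt_piece (k l : ℤ) (z : ℝ × ℝ) : HasFDerivAt (piece x y N k l)
    (gradForm (N.local x y bezierU k l z / step x k) (N.local x y bezierW k l z / step y l)) z := by
  have hu : HasFDerivAt (fun z : ℝ × ℝ => coord x k z.1)
      ((step x k)⁻¹ • ContinuousLinearMap.fst ℝ ℝ ℝ) z := by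
    have h : HasFDerivAt (fun z : ℝ × ℝ => z.1) (ContinuousLinearMap.fst ℝ ℝ ℝ) z := hasFDerivAt_fst
    exact (h.sub_const _).mul_const (step x k)⁻¹
  have hw : HasFDerivAt (fun z : ℝ × ℝ => coord y l z.2)
      ((step y l)⁻¹ • ContinuousLinearMap.snd ℝ ℝ ℝ) z := by
    have h : HasFDerivAt (fun z : ℝ × ℝ => z.2) (ContinuousLinearMap.snd ℝ ℝ ℝ) z := hasFDerivAt_snd
    exact (h.sub_const _).mul_const (step y l)⁻¹
  have := (hasFDerivAt_bezier (N.1 (k - 1) (l - 1)) (N.1 k (l - 1)) (N.1 (k - 1) l) (N.1 k l)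
    (N.2.1 k (l - 1)) (N.2.1 k l) (N.2.2 (k - 1) l) (N.2.2 k l)
    (coord x k z.1, coord y l z.2)).comp z (hu.prodMk hw)
  refine this.congr_fderiv ?_
  ext <;> simp [gradForm, Net.local, div_eq_mul_inv]

theorem contDiff_glue_piece (hx : IsKnots x) (hy : IsKnots y) (hN : N.Smooth x y) :
    ContDiff ℝ 1 (glue x y (piece x y N)) := by
  refine contDiff_glue hx hy (matches_piece hx hy) (matches_pieceU hx hy hN)
    (matches_pieceW hx hy hN) (fun k l => ?_) (fun k l => ?_) hasFDerivAt_piece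
  · unfold Net.local bezierU coord
    fun_prop
  · unfold Net.local bezierW coord
    fun_prop

end Smooth

/-! ### Quadratic polynomials -/

/-- The quadratic polynomial functions on the plane. -/
def IsQuadratic (f : ℝ × ℝ → ℝ) : Prop :=
  ∃ c₀ c₁ c₂ c₃ c₄ c₅ : ℝ, ∀ z : ℝ × ℝ,
    f z = c₀ + c₁ * z.1 + c₂ * z.2 + c₃ * z.1 ^ 2 + c₄ * (z.1 * z.2) + c₅ * z.2 ^ 2

theorem IsQuadratic.exists_polynomial {f : ℝ × ℝ → ℝ} (hf : IsQuadratic f) :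
    ∃ p : MvPolynomial (Fin 2) ℝ, p.totalDegree ≤ 2 ∧ ∀ z, f z = polyFun p z := by
  obtain ⟨c₀, c₁, c₂, c₃, c₄, c₅, h⟩ := hf
  refine ⟨MvPolynomial.C c₀ + MvPolynomial.C c₁ * MvPolynomial.X 0
    + MvPolynomial.C c₂ * MvPolynomial.X 1 + MvPolynomial.C c₃ * MvPolynomial.X 0 ^ 2
    + MvPolynomial.C c₄ * (MvPolynomial.X 0 * MvPolynomial.X 1)
    + MvPolynomial.C c₅ * MvPolynomial.X 1 ^ 2, ?_, fun z => ?_⟩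
  · have hX : ∀ i : Fin 2, (MvPolynomial.X i : MvPolynomial (Fin 2) ℝ).totalDegree ≤ 1 := fun i =>
      (MvPolynomial.totalDegree_X i).le
    have hC : ∀ (c : ℝ) (q : MvPolynomial (Fin 2) ℝ) (n : ℕ), q.totalDegree ≤ n →
        (MvPolynomial.C c * q).totalDegree ≤ n := fun c q n hq =>
      (MvPolynomial.totalDegree_mul _ _).trans (by simpa using hq)
    have hsq : ∀ i : Fin 2, (MvPolynomial.X i ^ 2 : MvPolynomial (Fin 2) ℝ).totalDegree ≤ 2 :=
      fun i => (MvPolynomial.totalDegree_pow _ _).trans (by have := hX i; omega)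
    have hadd : ∀ q r : MvPolynomial (Fin 2) ℝ, q.totalDegree ≤ 2 → r.totalDegree ≤ 2 →
        (q + r).totalDegree ≤ 2 := fun q r hq hr =>
      (MvPolynomial.totalDegree_add _ _).trans (max_le hq hr)
    refine hadd _ _ (hadd _ _ (hadd _ _ (hadd _ _ (hadd _ _ (by simp) ?_) ?_) ?_) ?_) ?_
    · exact hC _ _ _ ((hX 0).trans one_le_two)
    · exact hC _ _ _ ((hX 1).trans one_le_two)
    · exact hC _ _ _ (hsq 0)
    · exact hC _ _ _ ((MvPolynomial.totalDegree_mul _ _).trans (add_le_add (hX 0) (hX 1)))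
    · exact hC _ _ _ (hsq 1)
  · rw [h]
    simp [polyFun]

theorem isQuadratic_polyFun {p : MvPolynomial (Fin 2) ℝ} (hp : p.totalDegree ≤ 2) :
    IsQuadratic (polyFun p) := by
  have hsum : polyFun p
      = ∑ d ∈ p.support, fun z : ℝ × ℝ => p.coeff d * (z.1 ^ d 0 * z.2 ^ d 1) := by
    ext z
    simp [polyFun, MvPolynomial.eval_eq', Fin.prod_univ_two]
  rw [hsum]
  refine Finset.sum_induction _ _ ?_ ⟨0, 0, 0, 0, 0, 0, by simp⟩ fun d hd => ?_
  · rintro f g ⟨c₀, c₁, c₂, c₃, c₄, c₅, h⟩ ⟨d₀, d₁, d₂, d₃, d₄, d₅, h'⟩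
    refine ⟨c₀ + d₀, c₁ + d₁, c₂ + d₂, c₃ + d₃, c₄ + d₄, c₅ + d₅, fun z => ?_⟩
    rw [Pi.add_apply, h, h']
    ring
  · have hle := (MvPolynomial.le_totalDegree hd).trans hp
    rw [Finsupp.sum_fintype _ _ (fun _ => rfl), Fin.sum_univ_two] at hle
    generalize p.coeff d = c
    generalize d 0 = m at *
    generalize d 1 = n at *
    have hm : m ≤ 2 := by omega
    interval_cases m
    · have hn : n ≤ 2 := by omega
      interval_cases n
      · exact ⟨c, 0, 0, 0, 0, 0, fun z => by ring⟩
      · exact ⟨0, 0, c, 0, 0, 0, fun z => by ring⟩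
      · exact ⟨0, 0, 0, 0, 0, c, fun z => by ring⟩
    · have hn : n ≤ 1 := by omega
      interval_cases n
      · exact ⟨0, c, 0, 0, 0, 0, fun z => by ring⟩
      · exact ⟨0, 0, 0, 0, c, 0, fun z => by ring⟩
    · have hn : n = 0 := by omega
      subst hn
      exact ⟨0, 0, 0, c, 0, 0, fun z => by ring⟩

theorem IsQuadratic.comp_affine {f : ℝ × ℝ → ℝ} (hf : IsQuadratic f) (p q r s : ℝ) :
    IsQuadratic fun z => f (p * z.1 + q, r * z.2 + s) := by
  obtain ⟨c₀, c₁, c₂, c₃, c₄, c₅, h⟩ := hf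
  refine ⟨c₀ + c₁ * q + c₂ * s + c₃ * q ^ 2 + c₄ * (q * s) + c₅ * s ^ 2,
    c₁ * p + 2 * c₃ * p * q + c₄ * p * s, c₂ * r + c₄ * q * r + 2 * c₅ * r * s,
    c₃ * p ^ 2, c₄ * p * r, c₅ * r ^ 2, fun z => ?_⟩
  exact (h _).trans (by ring)

theorem isQuadratic_bezier_of_sign (v00 v01 eS eN eW eE σ τ : ℝ) :
    IsQuadratic fun z => v00 * (1 - z.1 - z.2) ^ 2 + v01 * (z.2 - z.1) ^ 2
      + 2 * eW * ((1 - z.1 - z.2) * (z.2 - z.1))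
      + 2 * z.1 * ((eS + eW) * (1 - z.1 - z.2) + (eN + eW) * (z.2 - z.1))
      + (eS + eE + eN + eW) * z.1 ^ 2 + σ * (z.1 - z.2) ^ 2 + τ * (z.1 + z.2 - 1) ^ 2 := by
  refine ⟨v00 + τ, -2 * v00 - 2 * τ + 2 * (eS + eW) - 2 * eW,
    -2 * v00 + 2 * eW - 2 * τ, v00 + v01 + 2 * eW - 2 * (eS + eW) - 2 * (eN + eW)
      + (eS + eE + eN + eW) + σ + τ,
    2 * v00 - 2 * v01 - 2 * (eS + eW) + 2 * (eN + eW) - 2 * σ + 2 * τ,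
    v00 + v01 - 2 * eW + σ + τ, fun z => ?_⟩
  ring

/-- On one side of a diagonal a truncated square is either 0 or the full square, so it becomes σ or
τ times a square with a factor 0 or 1. -/
theorem exists_isQuadratic_bezier {S : Set (ℝ × ℝ)}
    (h₁ : (∀ z ∈ S, z.2 ≤ z.1) ∨ ∀ z ∈ S, z.1 ≤ z.2)
    (h₂ : (∀ z ∈ S, 1 ≤ z.1 + z.2) ∨ ∀ z ∈ S, z.1 + z.2 ≤ 1)
    (v00 v10 v01 v11 eS eN eW eE : ℝ) :
    ∃ g, IsQuadratic g ∧ ∀ z ∈ S, bezier v00 v10 v01 v11 eS eN eW eE z.1 z.2 = g z := by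
  have h₁' : ∃ σ : ℝ, ∀ z ∈ S, max 0 (z.1 - z.2) ^ 2 = σ * (z.1 - z.2) ^ 2 := by
    rcases h₁ with h | h
    · exact ⟨1, fun z hz => by rw [max_eq_right (sub_nonneg.2 (h z hz)), one_mul]⟩
    · exact ⟨0, fun z hz => by rw [max_eq_left (sub_nonpos.2 (h z hz))]; simp⟩
  have h₂' : ∃ τ : ℝ, ∀ z ∈ S, max 0 (z.1 + z.2 - 1) ^ 2 = τ * (z.1 + z.2 - 1) ^ 2 := by
    rcases h₂ with h | h
    · exact ⟨1, fun z hz => by rw [max_eq_right (sub_nonneg.2 (h z hz)), one_mul]⟩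
    · exact ⟨0, fun z hz => by rw [max_eq_left (sub_nonpos.2 (h z hz))]; simp⟩
  obtain ⟨σ, hσ⟩ := h₁'
  obtain ⟨τ, hτ⟩ := h₂'
  refine ⟨_, isQuadratic_bezier_of_sign v00 v01 eS eN eW eE
    ((v10 - v01 + eN + eW - eS - eE) * σ) ((v11 - v00 + eS + eW - eN - eE) * τ), fun z hz => ?_⟩
  rw [bezier, hσ z hz, hτ z hz]
  ring

/-! ### Splines from nets -/

theorem coord_mid {x : ℤ → ℝ} (hx : IsKnots x) (k : ℤ) : coord x k (mid x k) = 1 / 2 := by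
  have h : x k - x (k - 1) ≠ 0 := (hx.step_pos k).ne'
  rw [coord, mid, step]
  field_simp
  ring

theorem coord_prev (x : ℤ → ℝ) (k : ℤ) : coord x k (x (k - 1)) = 0 := by
  simp [coord]

theorem mem_rect_of_coord {x y : ℤ → ℝ} (hx : IsKnots x) (hy : IsKnots y) {k l : ℤ} {z : ℝ × ℝ}
    (h₁ : 0 ≤ coord x k z.1) (h₂ : coord x k z.1 ≤ 1) (h₃ : 0 ≤ coord y l z.2)
    (h₄ : coord y l z.2 ≤ 1) : z ∈ rect x y k l := by
  have e₁ : step x k = x k - x (k - 1) := rfl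
  have e₂ : step y l = y l - y (l - 1) := rfl
  have p₁ := hx.step_pos k
  have p₂ := hy.step_pos l
  rw [coord, le_div_iff₀ p₁] at h₁
  rw [coord, le_div_iff₀ p₂] at h₃
  rw [coord, div_le_one p₁] at h₂
  rw [coord, div_le_one p₂] at h₄
  exact ⟨⟨by linarith, by linarith⟩, by linarith, by linarith⟩

/-- A half-plane is convex, and the local coordinates are affine; an affine inequality on a triangle
thus needs checking only at its vertices. -/
theorem le_zero_of_mem_convexHull {x y : ℤ → ℝ} {k l : ℤ} (α β γ : ℝ) {p q r z : ℝ × ℝ}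
    (hz : z ∈ convexHull ℝ {p, q, r})
    (hp : α * coord x k p.1 + β * coord y l p.2 + γ ≤ 0)
    (hq : α * coord x k q.1 + β * coord y l q.2 + γ ≤ 0)
    (hr : α * coord x k r.1 + β * coord y l r.2 + γ ≤ 0) :
    α * coord x k z.1 + β * coord y l z.2 + γ ≤ 0 := by
  have hconv : Convex ℝ {z : ℝ × ℝ | α * coord x k z.1 + β * coord y l z.2 + γ ≤ 0} := by
    intro v hv w hw s t hs ht hst
    simp only [Set.mem_ofPred_eq] at hv hw ⊢
    have h₁ : coord x k (s • v + t • w).1 = s * coord x k v.1 + t * coord x k w.1 := by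
      simp only [coord, Prod.fst_add, Prod.smul_fst, smul_eq_mul]
      linear_combination (x (k - 1) / step x k) * hst
    have h₂ : coord y l (s • v + t • w).2 = s * coord y l v.2 + t * coord y l w.2 := by
      simp only [coord, Prod.snd_add, Prod.smul_snd, smul_eq_mul]
      linear_combination (y (l - 1) / step y l) * hst
    rw [h₁, h₂]
    have := add_nonpos (mul_nonpos_of_nonneg_of_nonpos hs hv)
      (mul_nonpos_of_nonneg_of_nonpos ht hw)
    linear_combination this - γ * hst
  refine convexHull_min ?_ hconv hz
  rintro v (rfl | rfl | rfl)
  · exact hp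
  · exact hq
  · exact hr

theorem isQuadratic_piece_of_sign {x y : ℤ → ℝ} (N : Net) (k l : ℤ) {τ : Set (ℝ × ℝ)}
    (h₁ : (∀ z ∈ τ, coord y l z.2 ≤ coord x k z.1) ∨ ∀ z ∈ τ, coord x k z.1 ≤ coord y l z.2)
    (h₂ : (∀ z ∈ τ, 1 ≤ coord x k z.1 + coord y l z.2) ∨
      ∀ z ∈ τ, coord x k z.1 + coord y l z.2 ≤ 1) :
    ∃ g, IsQuadratic g ∧ ∀ z ∈ τ, piece x y N k l z = g z := by
  obtain ⟨g, hg, h⟩ := exists_isQuadratic_bezier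
    (S := (fun z : ℝ × ℝ => (coord x k z.1, coord y l z.2)) '' τ)
    (by simpa only [Set.forall_mem_image] using h₁) (by simpa only [Set.forall_mem_image] using h₂)
    (N.1 (k - 1) (l - 1)) (N.1 k (l - 1)) (N.1 (k - 1) l) (N.1 k l)
    (N.2.1 k (l - 1)) (N.2.1 k l) (N.2.2 (k - 1) l) (N.2.2 k l)
  refine ⟨_, hg.comp_affine (step x k)⁻¹ (-x (k - 1) / step x k) (step y l)⁻¹
    (-y (l - 1) / step y l), fun z hz => ?_⟩
  refine (h _ (Set.mem_image_of_mem _ hz)).trans ?_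
  simp only [coord]
  congr 2 <;> ring

/-- Lying in the rectangle and on a given side of each diagonal are affine inequalities in the local
coordinates. At the vertices these coordinates are 0, 1/2 or 1, which leaves numerical checks. -/
theorem exists_rect_of_isTriangle {x y : ℤ → ℝ} (hx : IsKnots x) (hy : IsKnots y)
    {τ : Set (ℝ × ℝ)} (hτ : IsTriangle x y τ) :
    ∃ k l, τ ⊆ rect x y k l ∧
      ((∀ z ∈ τ, coord y l z.2 ≤ coord x k z.1) ∨ ∀ z ∈ τ, coord x k z.1 ≤ coord y l z.2) ∧
      ((∀ z ∈ τ, 1 ≤ coord x k z.1 + coord y l z.2) ∨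
        ∀ z ∈ τ, coord x k z.1 + coord y l z.2 ≤ 1) := by
  obtain ⟨k, l, h⟩ := hτ
  have key : ∀ (p q r : ℝ × ℝ), τ = convexHull ℝ {p, q, r} → ∀ α β γ : ℝ,
      α * coord x k p.1 + β * coord y l p.2 + γ ≤ 0 →
      α * coord x k q.1 + β * coord y l q.2 + γ ≤ 0 →
      α * coord x k r.1 + β * coord y l r.2 + γ ≤ 0 →
      ∀ z ∈ τ, α * coord x k z.1 + β * coord y l z.2 + γ ≤ 0 := by
    rintro p q r rfl α β γ hp hq hr z hz
    exact le_zero_of_mem_convexHull α β γ hz hp hq hr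
  have hcoord : ∀ z : ℝ × ℝ, -coord x k z.1 ≤ 0 → coord x k z.1 - 1 ≤ 0 → -coord y l z.2 ≤ 0 →
      coord y l z.2 - 1 ≤ 0 → z ∈ rect x y k l := fun z h₁ h₂ h₃ h₄ =>
    mem_rect_of_coord hx hy (by linarith) (by linarith) (by linarith) (by linarith)
  refine ⟨k, l, ?_⟩
  rcases h with h | h | h | h
  all_goals
    have key' := key _ _ _ h
    simp only [center, coord_mid hx, coord_mid hy, coord_prev, coord_right hx, coord_right hy]
      at key'
    refine ⟨fun z hz => hcoord z ?_ ?_ ?_ ?_, ?_, ?_⟩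
    · linarith [key' (-1) 0 0 (by norm_num) (by norm_num) (by norm_num) z hz]
    · linarith [key' 1 0 (-1) (by norm_num) (by norm_num) (by norm_num) z hz]
    · linarith [key' 0 (-1) 0 (by norm_num) (by norm_num) (by norm_num) z hz]
    · linarith [key' 0 1 (-1) (by norm_num) (by norm_num) (by norm_num) z hz]
  · exact Or.inl fun z hz => by
      linarith [key' (-1) 1 0 (by norm_num) (by norm_num) (by norm_num) z hz]
  · exact Or.inr fun z hz => by
      linarith [key' 1 1 (-1) (by norm_num) (by norm_num) (by norm_num) z hz]
  · exact Or.inl fun z hz => by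
      linarith [key' (-1) 1 0 (by norm_num) (by norm_num) (by norm_num) z hz]
  · exact Or.inl fun z hz => by
      linarith [key' (-1) (-1) 1 (by norm_num) (by norm_num) (by norm_num) z hz]
  · exact Or.inr fun z hz => by
      linarith [key' 1 (-1) 0 (by norm_num) (by norm_num) (by norm_num) z hz]
  · exact Or.inl fun z hz => by
      linarith [key' (-1) (-1) 1 (by norm_num) (by norm_num) (by norm_num) z hz]
  · exact Or.inr fun z hz => by
      linarith [key' 1 (-1) 0 (by norm_num) (by norm_num) (by norm_num) z hz]
  · exact Or.inr fun z hz => by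
      linarith [key' 1 1 (-1) (by norm_num) (by norm_num) (by norm_num) z hz]

theorem Net.Smooth.isC1QuadraticSpline {x y : ℤ → ℝ} {N : Net} (hN : N.Smooth x y)
    (hx : IsKnots x) (hy : IsKnots y) : IsC1QuadraticSpline x y (glue x y (piece x y N)) := by
  refine ⟨contDiff_glue_piece hx hy hN, fun τ hτ => ?_⟩
  obtain ⟨k, l, hsub, h₁, h₂⟩ := exists_rect_of_isTriangle hx hy hτ
  obtain ⟨g, hg, h⟩ := isQuadratic_piece_of_sign N k l h₁ h₂
  obtain ⟨p, hp, hgp⟩ := hg.exists_polynomial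
  exact ⟨p, hp, fun z hz => by
    rw [(matches_piece hx hy).glue_eq hx hy (hsub hz), h z hz, hgp z]⟩

/-! ### The nets of the B-splines and of their combinations -/

/-- The coefficients of `bspline x y i j`. -/
noncomputable def bsplineNet (x y : ℤ → ℝ) (i j : ℤ) : Net :=
  (fun k l => knotVal x i k * knotVal y j l, fun k l => midCoef i k * knotVal y j l,
    fun k l => knotVal x i k * midCoef j l)

theorem abs_sub_mid_div_step {x : ℤ → ℝ} (hx : IsKnots x) (k : ℤ) (t : ℝ) :
    |t - mid x k| / step x k = |coord x k t - 1 / 2| := by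
  have h := hx.step_pos k
  have e : step x k = x k - x (k - 1) := rfl
  nth_rw 1 [← abs_of_pos h]
  rw [← abs_div, coord, mid]
  congr 1
  field_simp
  rw [e]
  ring

theorem pyramid_eq {x y : ℤ → ℝ} (hx : IsKnots x) (hy : IsKnots y) (k l : ℤ) (z : ℝ × ℝ) :
    pyramid x y k l z
      = max 0 (1 - 2 * max |coord x k z.1 - 1 / 2| |coord y l z.2 - 1 / 2|) := by
  rw [pyramid, abs_sub_mid_div_step hx, abs_sub_mid_div_step hy]

/-- On each of the four triangles two vertex coordinates vanish and the pyramid is linear (for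
example `q = 2 * u` on the left one), so the identity becomes polynomial. Outside the square the two
formulas are different extensions. -/
theorem bezier_eq_barycentric (v00 v10 v01 v11 eS eN eW eE : ℝ) {u w : ℝ} (hu : 0 ≤ u)
    (hu' : u ≤ 1) (hw : 0 ≤ w) (hw' : w ≤ 1) {p00 p10 p01 p11 q : ℝ} (h00 : p00 = max 0 (1 - u - w))
    (h10 : p10 = max 0 (u - w)) (h01 : p01 = max 0 (w - u)) (h11 : p11 = max 0 (u + w - 1))
    (hq : q = max 0 (1 - 2 * max |u - 1 / 2| |w - 1 / 2|)) :
    v00 * p00 ^ 2 + v10 * p10 ^ 2 + v01 * p01 ^ 2 + v11 * p11 ^ 2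
      + 2 * (eS * (p00 * p10) + eE * (p10 * p11) + eN * (p01 * p11) + eW * (p00 * p01))
      + 2 * q * ((eS + eW) / 2 * p00 + (eS + eE) / 2 * p10 + (eN + eW) / 2 * p01
        + (eN + eE) / 2 * p11)
      + (eS + eE + eN + eW) / 4 * q ^ 2 = bezier v00 v10 v01 v11 eS eN eW eE u w := by
  rw [bezier, ← h10, ← h11]
  rcases le_total u w with h | h <;> rcases le_total (u + w) 1 with h' | h'
  · rw [max_eq_left (by linarith)] at h10 h11
    rw [max_eq_right (by linarith)] at h00 h01
    rw [max_eq_left (abs_le.2 ⟨by rw [abs_of_nonpos] <;> linarith,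
      by rw [abs_of_nonpos] <;> linarith⟩), abs_of_nonpos (by linarith),
      max_eq_right (by linarith)] at hq
    subst h00 h01 h10 h11 hq
    ring
  · rw [max_eq_left (by linarith)] at h10 h00
    rw [max_eq_right (by linarith)] at h11 h01
    rw [max_eq_right (abs_le.2 ⟨by rw [abs_of_nonneg] <;> linarith,
      by rw [abs_of_nonneg] <;> linarith⟩), abs_of_nonneg (by linarith),
      max_eq_right (by linarith)] at hq
    subst h00 h01 h10 h11 hq
    ring
  · rw [max_eq_left (by linarith)] at h01 h11
    rw [max_eq_right (by linarith)] at h00 h10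
    rw [max_eq_right (abs_le.2 ⟨by rw [abs_of_nonpos] <;> linarith,
      by rw [abs_of_nonpos] <;> linarith⟩), abs_of_nonpos (by linarith),
      max_eq_right (by linarith)] at hq
    subst h00 h01 h10 h11 hq
    ring
  · rw [max_eq_left (by linarith)] at h01 h00
    rw [max_eq_right (by linarith)] at h11 h10
    rw [max_eq_left (abs_le.2 ⟨by rw [abs_of_nonneg] <;> linarith,
      by rw [abs_of_nonneg] <;> linarith⟩), abs_of_nonneg (by linarith),
      max_eq_right (by linarith)] at hq
    subst h00 h01 h10 h11 hq
    ring

theorem patch_eq_piece {x y : ℤ → ℝ} (hx : IsKnots x) (hy : IsKnots y) (i j : ℤ) {k l : ℤ}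
    {z : ℝ × ℝ} (hz : z ∈ rect x y k l) :
    patch x y i j k l z = piece x y (bsplineNet x y i j) k l z := by
  obtain ⟨h₀, h₁⟩ := coord_mem hx hz.1
  obtain ⟨h₂, h₃⟩ := coord_mem hy hz.2
  exact bezier_eq_barycentric _ _ _ _ _ _ _ _ h₀ h₁ h₂ h₃ rfl rfl rfl rfl (pyramid_eq hx hy k l z)

theorem knotVal_eq_zero (x : ℤ → ℝ) {i k : ℤ} (h : k < i - 1 ∨ i < k) : knotVal x i k = 0 := by
  rw [knotVal, if_neg (by omega), if_neg (by omega)]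

theorem midCoef_eq_zero {i k : ℤ} (h : k ≠ i) : midCoef i k = 0 := if_neg h

theorem piece_bsplineNet_eq_zero (x y : ℤ → ℝ) {i j k l : ℤ} (z : ℝ × ℝ)
    (h : ¬ ((i - 1 ≤ k ∧ k ≤ i + 1) ∧ j - 1 ≤ l ∧ l ≤ j + 1)) :
    piece x y (bsplineNet x y i j) k l z = 0 := by
  by_cases hk : i - 1 ≤ k ∧ k ≤ i + 1
  · have hl : l < j - 1 ∨ j + 1 < l := by by_contra; exact h ⟨hk, by omega⟩
    simp [piece, Net.local, bezier, bsplineNet, knotVal_eq_zero y (i := j) (k := l) (by omega),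
      knotVal_eq_zero y (i := j) (k := l - 1) (by omega), midCoef_eq_zero (by omega : l ≠ j)]
  · simp [piece, Net.local, bezier, bsplineNet, knotVal_eq_zero x (i := i) (k := k) (by omega),
      knotVal_eq_zero x (i := i) (k := k - 1) (by omega), midCoef_eq_zero (by omega : k ≠ i)]

/-- Exactly one half-open rectangle contains the point, so at most one term of the double sum
survives. Outside the 3 × 3 block all coefficients of the net that enter the piece vanish, so gluing
over the whole plane adds nothing. -/
theorem bspline_eq_glue {x y : ℤ → ℝ} (hx : IsKnots x) (hy : IsKnots y) (i j : ℤ) :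
    bspline x y i j = glue x y (piece x y (bsplineNet x y i j)) := by
  ext z
  have hz := mem_rect_index hx hy z
  have hind : ∀ k l : ℤ,
      (Set.Ico (x (k - 1)) (x k) ×ˢ Set.Ico (y (l - 1)) (y l)).indicator (patch x y i j k l) z
        = if k = knotIndex x z.1 then if l = knotIndex y z.2 then
          piece x y (bsplineNet x y i j) k l z else 0 else 0 := by
    intro k l
    by_cases hm : z ∈ Set.Ico (x (k - 1)) (x k) ×ˢ Set.Ico (y (l - 1)) (y l)
    · rw [Set.indicator_of_mem hm, if_pos (hx.index_eq hm.1.1 hm.1.2).symm,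
        if_pos (hy.index_eq hm.2.1 hm.2.2).symm]
      exact patch_eq_piece hx hy i j ⟨⟨hm.1.1, hm.1.2.le⟩, hm.2.1, hm.2.2.le⟩
    · rw [Set.indicator_of_notMem hm]
      split_ifs with h h'
      · refine absurd ⟨⟨?_, ?_⟩, ?_, ?_⟩ hm
        · exact h ▸ hx.index_le _
        · exact h ▸ hx.lt_index _
        · exact h' ▸ hy.index_le _
        · exact h' ▸ hy.lt_index _
      · rfl
      · rfl
  rw [bspline, glue]
  simp only [hind]
  rw [Finset.sum_congr rfl fun k _ => Finset.sum_ite_irrel (k = knotIndex x z.1) _ _ _]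
  simp only [Finset.sum_ite_eq', Finset.sum_const_zero, Finset.mem_Icc]
  split_ifs with h h'
  · rfl
  · exact (piece_bsplineNet_eq_zero x y z fun h'' => h' h''.2).symm
  · exact (piece_bsplineNet_eq_zero x y z fun h'' => h h''.1).symm

/-- The average of `g k` and `g (k+1)` with the weights of the values of the univariate B-splines
at the knot `x k`. -/
noncomputable def knotAvg (x : ℤ → ℝ) (g : ℤ → ℝ) (k : ℤ) : ℝ :=
  (step x (k + 1) * g k + step x k * g (k + 1)) / (step x k + step x (k + 1))

/-- The coefficients of `∑ c i j * bspline x y i j`. -/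
noncomputable def combNet (x y : ℤ → ℝ) (c : ℤ → ℤ → ℝ) : Net :=
  (fun k l => knotAvg x (fun i => knotAvg y (c i) l) k, fun k l => knotAvg y (c k) l,
    fun k l => knotAvg x (fun i => c i l) k)

/-- `knotAvg x g k` is the value at the knot of the affine function taking the values `g k` and `g
(k + 1)` at distances `step x k` to the left and `step x (k + 1)` to the right, whence equal slopes
on both sides. -/
theorem knotAvg_slope {x : ℤ → ℝ} (hx : IsKnots x) (g : ℤ → ℝ) (k : ℤ) :
    (knotAvg x g k - g k) / step x k = (g (k + 1) - knotAvg x g k) / step x (k + 1) := by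
  have h₁ := hx.step_pos k
  have h₂ := hx.step_pos (k + 1)
  have h₃ : step x k + step x (k + 1) ≠ 0 := by positivity
  rw [knotAvg]
  field_simp
  ring

theorem knotAvg_comm (x y : ℤ → ℝ) (c : ℤ → ℤ → ℝ) (k l : ℤ) :
    knotAvg x (fun i => knotAvg y (c i) l) k = knotAvg y (fun j => knotAvg x (fun i => c i j) k) l := by
  simp only [knotAvg]
  ring

/-- A vertex coefficient is an average in one direction of the neighbouring side coefficients, which
is precisely the slope condition. By `knotAvg_comm` it is such an average in either direction. -/
theorem combNet_smooth {x y : ℤ → ℝ} (hx : IsKnots x) (hy : IsKnots y) (c : ℤ → ℤ → ℝ) :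
    (combNet x y c).Smooth x y where
  horizontal k l := knotAvg_slope hx (fun i => knotAvg y (c i) l) k
  vertical k l := by
    have := knotAvg_slope hy (fun j => knotAvg x (fun i => c i j) k) l
    rwa [← knotAvg_comm] at this

/-- `piece` as a linear map of the coefficients. -/
noncomputable def pieceₗ (x y : ℤ → ℝ) (k l : ℤ) (z : ℝ × ℝ) : Net →ₗ[ℝ] ℝ where
  toFun N := piece x y N k l z
  map_add' N N' := by
    simp only [piece, Net.local, bezier, Prod.fst_add, Prod.snd_add, Pi.add_apply]
    ring
  map_smul' r N := by
    simp only [piece, Net.local, bezier, Prod.smul_fst, Prod.smul_snd, Pi.smul_apply, smul_eq_mul,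
      RingHom.id_apply]
    ring

theorem sum_Icc_three (g : ℤ → ℝ) (k : ℤ) :
    ∑ i ∈ Finset.Icc (k - 1) (k + 1), g i = g (k - 1) + g k + g (k + 1) := by
  have : Finset.Icc (k - 1) (k + 1) = {k - 1, k, k + 1} := by
    ext i
    simp only [Finset.mem_Icc, Finset.mem_insert, Finset.mem_singleton]
    omega
  rw [this, Finset.sum_insert (by simp; omega), Finset.sum_insert (by simp), Finset.sum_singleton]
  ring

/-- Only the univariate B-splines with indices `m` and `m + 1` are nonzero at the knot `x m`, and
both indices lie in the range of summation. -/
theorem sum_mul_knotVal (x : ℤ → ℝ) (g : ℤ → ℝ) {k m : ℤ} (hm : m = k - 1 ∨ m = k) :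
    ∑ i ∈ Finset.Icc (k - 1) (k + 1), g i * knotVal x i m = knotAvg x g m := by
  have h₀ : knotVal x m m = step x (m + 1) / (step x m + step x (m + 1)) := by
    rw [knotVal, if_neg (by omega), if_pos rfl]
  have h₁ : knotVal x (m + 1) m = step x m / (step x m + step x (m + 1)) := by
    rw [knotVal, if_pos (by omega), add_sub_cancel_right]
  rw [sum_Icc_three]
  rcases hm with rfl | rfl
  · rw [sub_add_cancel] at h₀ h₁
    rw [h₀, h₁, knotVal_eq_zero x (by omega), knotAvg, sub_add_cancel]
    ring
  · rw [h₀, h₁, knotVal_eq_zero x (by omega), knotAvg]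
    ring

theorem sum_mul_midCoef (g : ℤ → ℝ) (k : ℤ) :
    ∑ i ∈ Finset.Icc (k - 1) (k + 1), g i * midCoef i k = g k := by
  simp [midCoef]

/-- A piece is linear in its net, and the B-spline nets are products of univariate data, so the sums
factor into one sum per direction. Only the eight coefficients used on the rectangle have to be
compared, and for these the nine indices suffice. -/
theorem sum_mul_piece (x y : ℤ → ℝ) (c : ℤ → ℤ → ℝ) (k l : ℤ) (z : ℝ × ℝ) :
    ∑ i ∈ Finset.Icc (k - 1) (k + 1), ∑ j ∈ Finset.Icc (l - 1) (l + 1),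
      c i j * piece x y (bsplineNet x y i j) k l z = piece x y (combNet x y c) k l z := by
  have hlin : ∑ i ∈ Finset.Icc (k - 1) (k + 1), ∑ j ∈ Finset.Icc (l - 1) (l + 1),
      c i j * piece x y (bsplineNet x y i j) k l z
      = pieceₗ x y k l z (∑ i ∈ Finset.Icc (k - 1) (k + 1), ∑ j ∈ Finset.Icc (l - 1) (l + 1),
        c i j • bsplineNet x y i j) := by
    simp only [map_sum, map_smul, smul_eq_mul]
    rfl
  rw [hlin]
  change piece x y _ k l z = _
  set N := ∑ i ∈ Finset.Icc (k - 1) (k + 1), ∑ j ∈ Finset.Icc (l - 1) (l + 1),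
        c i j • bsplineNet x y i j with hN
  have hV : ∀ m n, (m = k - 1 ∨ m = k) → (n = l - 1 ∨ n = l) →
      N.1 m n = (combNet x y c).1 m n := by
    intro m n hm hn
    simp only [hN, Prod.fst_sum, Prod.smul_fst, Finset.sum_apply, Pi.smul_apply, smul_eq_mul,
      bsplineNet, combNet]
    rw [← sum_mul_knotVal x _ hm]
    refine Finset.sum_congr rfl fun i _ => ?_
    rw [← sum_mul_knotVal y _ hn, Finset.sum_mul]
    exact Finset.sum_congr rfl fun j _ => by ring
  have hH : ∀ n, (n = l - 1 ∨ n = l) → N.2.1 k n = (combNet x y c).2.1 k n := by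
    intro n hn
    simp only [hN, Prod.fst_sum, Prod.snd_sum, Prod.smul_fst, Prod.smul_snd, Finset.sum_apply,
      Pi.smul_apply, smul_eq_mul, bsplineNet, combNet]
    rw [← sum_mul_midCoef (fun i => knotAvg y (c i) n) k]
    refine Finset.sum_congr rfl fun i _ => ?_
    rw [← sum_mul_knotVal y _ hn, Finset.sum_mul]
    exact Finset.sum_congr rfl fun j _ => by ring
  have hE : ∀ m, (m = k - 1 ∨ m = k) → N.2.2 m l = (combNet x y c).2.2 m l := by
    intro m hm
    simp only [hN, Prod.snd_sum, Prod.smul_snd, Finset.sum_apply,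
      Pi.smul_apply, smul_eq_mul, bsplineNet, combNet]
    rw [← sum_mul_knotVal x _ hm]
    refine Finset.sum_congr rfl fun i _ => ?_
    rw [← sum_mul_midCoef (c i) l, Finset.sum_mul]
    exact Finset.sum_congr rfl fun j _ => by ring
  rw [piece, piece, Net.local, Net.local, hV _ _ (.inl rfl) (.inl rfl), hV _ _ (.inr rfl) (.inl rfl),
    hV _ _ (.inl rfl) (.inr rfl), hV _ _ (.inr rfl) (.inr rfl), hH _ (.inl rfl), hH _ (.inr rfl),
    hE _ (.inl rfl), hE _ (.inr rfl)]

/-- The indices of the B-splines that may be nonzero at `z`. -/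
noncomputable def activeIndices (x y : ℤ → ℝ) (z : ℝ × ℝ) : Finset (ℤ × ℤ) :=
  Finset.Icc (knotIndex x z.1 - 1) (knotIndex x z.1 + 1) ×ˢ
    Finset.Icc (knotIndex y z.2 - 1) (knotIndex y z.2 + 1)

theorem bspline_eq_zero_of_notMem {x y : ℤ → ℝ} (hx : IsKnots x) (hy : IsKnots y) {z : ℝ × ℝ}
    {ij : ℤ × ℤ} (h : ij ∉ activeIndices x y z) : bspline x y ij.1 ij.2 z = 0 := by
  rw [bspline_eq_glue hx hy, glue, piece_bsplineNet_eq_zero]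
  simp only [activeIndices, Finset.mem_product, Finset.mem_Icc] at h
  omega

theorem tsum_mul_bspline {x y : ℤ → ℝ} (hx : IsKnots x) (hy : IsKnots y) (c : ℤ × ℤ → ℝ)
    (z : ℝ × ℝ) : ∑' ij : ℤ × ℤ, c ij * bspline x y ij.1 ij.2 z
      = ∑ ij ∈ activeIndices x y z, c ij * bspline x y ij.1 ij.2 z :=
  tsum_eq_sum fun ij h => by rw [bspline_eq_zero_of_notMem hx hy h, mul_zero]

/-- At most nine B-splines are nonzero at a point, so the sum makes sense for arbitrary
coefficients, with no growth condition. -/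
theorem tsum_mul_bspline_eq_glue {x y : ℤ → ℝ} (hx : IsKnots x) (hy : IsKnots y)
    (c : ℤ → ℤ → ℝ) (z : ℝ × ℝ) : ∑' ij : ℤ × ℤ, c ij.1 ij.2 * bspline x y ij.1 ij.2 z
      = glue x y (piece x y (combNet x y c)) z := by
  rw [tsum_mul_bspline hx hy fun ij => c ij.1 ij.2, activeIndices, Finset.sum_product, glue,
    ← sum_mul_piece]
  simp only [bspline_eq_glue hx hy, glue]

theorem isC1QuadraticSpline_tsum {x y : ℤ → ℝ} (hx : IsKnots x) (hy : IsKnots y)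
    (c : ℤ → ℤ → ℝ) :
    IsC1QuadraticSpline x y fun z => ∑' ij : ℤ × ℤ, c ij.1 ij.2 * bspline x y ij.1 ij.2 z := by
  simp only [tsum_mul_bspline_eq_glue hx hy]
  exact (combNet_smooth hx hy c).isC1QuadraticSpline hx hy

/-- A single B-spline is the combination whose coefficients are a Kronecker delta. -/
theorem isC1QuadraticSpline_bspline {x y : ℤ → ℝ} (hx : IsKnots x) (hy : IsKnots y) (i j : ℤ) :
    IsC1QuadraticSpline x y (bspline x y i j) := by
  have h := isC1QuadraticSpline_tsum hx hy fun k l => if (k, l) = (i, j) then 1 else 0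
  convert h using 2 with z
  rw [tsum_eq_single (i, j) fun kl hkl => by rw [Prod.mk.eta, if_neg hkl, zero_mul]]
  simp

/-! ### Reproduction of quadratic polynomials -/

/-- The B-spline coefficients of 1, t, t² are their polar forms at `x (i - 1)`, `x i`, that is 1,
the midpoint and the product of the two knots; averaging them at a knot returns the values of the
polynomial there. -/
theorem knotAvg_greville {x : ℤ → ℝ} (hx : IsKnots x) (r s t : ℝ) (k : ℤ) :
    knotAvg x (fun i => r + s * mid x i + t * (x (i - 1) * x i)) k
      = r + s * x k + t * x k ^ 2 := by
  have h : step x k + step x (k + 1) ≠ 0 := (add_pos (hx.step_pos _) (hx.step_pos _)).ne'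
  rw [knotAvg, div_eq_iff h]
  simp only [step, mid, add_sub_cancel_right]
  ring

theorem tsum_mul_bspline_quadratic {x y : ℤ → ℝ} (hx : IsKnots x) (hy : IsKnots y)
    (c₀ c₁ c₂ c₃ c₄ c₅ : ℝ) (z : ℝ × ℝ) :
    ∑' ij : ℤ × ℤ, (c₀ + c₁ * mid x ij.1 + c₂ * mid y ij.2 + c₃ * (x (ij.1 - 1) * x ij.1)
      + c₄ * (mid x ij.1 * mid y ij.2) + c₅ * (y (ij.2 - 1) * y ij.2)) * bspline x y ij.1 ij.2 z
      = c₀ + c₁ * z.1 + c₂ * z.2 + c₃ * z.1 ^ 2 + c₄ * (z.1 * z.2) + c₅ * z.2 ^ 2 := by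
  refine (tsum_mul_bspline_eq_glue hx hy (fun i j => c₀ + c₁ * mid x i + c₂ * mid y j
    + c₃ * (x (i - 1) * x i) + c₄ * (mid x i * mid y j) + c₅ * (y (j - 1) * y j)) z).trans ?_
  have hH : ∀ i l, knotAvg y (fun j => c₀ + c₁ * mid x i + c₂ * mid y j
      + c₃ * (x (i - 1) * x i) + c₄ * (mid x i * mid y j) + c₅ * (y (j - 1) * y j)) l
      = (c₀ + c₂ * y l + c₅ * y l ^ 2) + (c₁ + c₄ * y l) * mid x i + c₃ * (x (i - 1) * x i) := by
    intro i l
    have := knotAvg_greville hy (c₀ + c₁ * mid x i + c₃ * (x (i - 1) * x i)) (c₂ + c₄ * mid x i) c₅ l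
    rw [← sub_eq_zero] at this ⊢
    rw [← this]
    simp only [knotAvg]
    ring
  have hE : ∀ k j, knotAvg x (fun i => c₀ + c₁ * mid x i + c₂ * mid y j
      + c₃ * (x (i - 1) * x i) + c₄ * (mid x i * mid y j) + c₅ * (y (j - 1) * y j)) k
      = c₀ + c₂ * mid y j + c₅ * (y (j - 1) * y j) + (c₁ + c₄ * mid y j) * x k + c₃ * x k ^ 2 := by
    intro k j
    have := knotAvg_greville hx (c₀ + c₂ * mid y j + c₅ * (y (j - 1) * y j)) (c₁ + c₄ * mid y j) c₃ k
    rw [← this]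
    congr 1
    ext i
    ring
  unfold glue
  set k := knotIndex x z.1
  set l := knotIndex y z.2
  simp only [piece, Net.local, combNet, hH, hE, knotAvg_greville hx]
  have e₁ := coord_spec hx k z.1
  have e₂ := coord_spec hy l z.2
  set u := coord x k z.1
  set w := coord y l z.2
  have s₁ : step x k = x k - x (k - 1) := rfl
  have s₂ : step y l = y l - y (l - 1) := rfl
  rw [s₁] at e₁
  rw [s₂] at e₂
  rw [e₁, e₂, bezier]
  simp only [mid]
  -- The factors of both truncated squares cancel, as a polynomial has no jump across the diagonals;
  -- no case distinction is needed.
  ring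

theorem tsum_bspline {x y : ℤ → ℝ} (hx : IsKnots x) (hy : IsKnots y) (z : ℝ × ℝ) :
    ∑' ij : ℤ × ℤ, bspline x y ij.1 ij.2 z = 1 := by
  simpa using tsum_mul_bspline_quadratic hx hy 1 0 0 0 0 0 z

/-! ### Positivity and support of the B-splines -/

theorem knotVal_nonneg {x : ℤ → ℝ} (hx : IsKnots x) (i k : ℤ) : 0 ≤ knotVal x i k := by
  have h := fun m => (hx.step_pos m).le
  rw [knotVal]
  split_ifs
  · exact div_nonneg (h _) (add_nonneg (h _) (h _))
  · exact div_nonneg (h _) (add_nonneg (h _) (h _))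
  · exact le_rfl

theorem knotVal_pos {x : ℤ → ℝ} (hx : IsKnots x) {i k : ℤ} (hk : k = i - 1 ∨ k = i) :
    0 < knotVal x i k := by
  have h := hx.step_pos
  rw [knotVal]
  split_ifs with h₁ h₂
  · exact div_pos (h _) (add_pos (h _) (h _))
  · exact div_pos (h _) (add_pos (h _) (h _))
  · omega

theorem midCoef_nonneg (i k : ℤ) : 0 ≤ midCoef i k := by
  rw [midCoef]
  split_ifs <;> norm_num

theorem midCoef_self (i : ℤ) : midCoef i i = 1 := if_pos rfl

/-- The Bernstein form shows the sign, which the truncated power form `bezier` hides: all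
coefficients and all truncated barycentric coordinates are nonnegative. -/
theorem patch_nonneg {x y : ℤ → ℝ} (hx : IsKnots x) (hy : IsKnots y) (i j k l : ℤ) (z : ℝ × ℝ) :
    0 ≤ patch x y i j k l z := by
  have h₁ := knotVal_nonneg hx i
  have h₂ := knotVal_nonneg hy j
  have h₃ := midCoef_nonneg
  have hq : 0 ≤ pyramid x y k l z := le_max_left _ _
  unfold patch
  have := h₁ k
  have := h₁ (k - 1)
  have := h₂ l
  have := h₂ (l - 1)
  have := h₃ i k
  have := h₃ j l
  positivity

theorem bspline_nonneg {x y : ℤ → ℝ} (hx : IsKnots x) (hy : IsKnots y) (i j : ℤ) (z : ℝ × ℝ) :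
    0 ≤ bspline x y i j z :=
  Finset.sum_nonneg fun k _ => Finset.sum_nonneg fun l _ =>
    Set.indicator_nonneg (fun z _ => patch_nonneg hx hy i j k l z) z

theorem bspline_eq_patch {x y : ℤ → ℝ} (hx : IsKnots x) (hy : IsKnots y) (i j : ℤ) (z : ℝ × ℝ) :
    bspline x y i j z = patch x y i j (knotIndex x z.1) (knotIndex y z.2) z := by
  rw [bspline_eq_glue hx hy, glue, patch_eq_piece hx hy i j (mem_rect_index hx hy z)]

/-- A patch is positive where one of the barycentric coordinates and the corresponding coefficient
are positive. -/
theorem patch_pos {x y : ℤ → ℝ} (hx : IsKnots x) (hy : IsKnots y) {i j k l : ℤ} {z : ℝ × ℝ}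
    (h : (0 < knotVal x i (k - 1) * knotVal y j (l - 1) ∧ coord x k z.1 + coord y l z.2 < 1) ∨
      (0 < knotVal x i k * knotVal y j (l - 1) ∧ coord y l z.2 < coord x k z.1) ∨
      (0 < knotVal x i (k - 1) * knotVal y j l ∧ coord x k z.1 < coord y l z.2) ∨
      (0 < knotVal x i k * knotVal y j l ∧ 1 < coord x k z.1 + coord y l z.2) ∨
      (0 < midCoef i k * knotVal y j (l - 1) + knotVal x i k * midCoef j l
        + midCoef i k * knotVal y j l + knotVal x i (k - 1) * midCoef j l ∧
        (0 < coord x k z.1 ∧ coord x k z.1 < 1) ∧ 0 < coord y l z.2 ∧ coord y l z.2 < 1)) :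
    0 < patch x y i j k l z := by
  have h₁ := knotVal_nonneg hx i k
  have h₂ := knotVal_nonneg hx i (k - 1)
  have h₃ := knotVal_nonneg hy j l
  have h₄ := knotVal_nonneg hy j (l - 1)
  have h₅ := midCoef_nonneg i k
  have h₆ := midCoef_nonneg j l
  have hq : 0 ≤ pyramid x y k l z := le_max_left _ _
  have hq' := pyramid_eq hx hy k l z
  unfold patch
  simp only []
  rw [← coord, ← coord]
  set u := coord x k z.1
  set w := coord y l z.2
  set q := pyramid x y k l z
  have h00 : 0 ≤ max 0 (1 - u - w) := le_max_left _ _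
  have h10 : 0 ≤ max 0 (u - w) := le_max_left _ _
  have h01 : 0 ≤ max 0 (w - u) := le_max_left _ _
  have h11 : 0 ≤ max 0 (u + w - 1) := le_max_left _ _
  have g00 : 1 - u - w ≤ max 0 (1 - u - w) := le_max_right _ _
  have g10 : u - w ≤ max 0 (u - w) := le_max_right _ _
  have g01 : w - u ≤ max 0 (w - u) := le_max_right _ _
  have g11 : u + w - 1 ≤ max 0 (u + w - 1) := le_max_right _ _
  set p00 := max 0 (1 - u - w)
  set p10 := max 0 (u - w)
  set p01 := max 0 (w - u)
  set p11 := max 0 (u + w - 1)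
  have n00 := mul_nonneg h₂ h₄
  have n10 := mul_nonneg h₁ h₄
  have n01 := mul_nonneg h₂ h₃
  have n11 := mul_nonneg h₁ h₃
  have nS := mul_nonneg h₅ h₄
  have nN := mul_nonneg h₅ h₃
  have nE := mul_nonneg h₁ h₆
  have nW := mul_nonneg h₂ h₆
  set v00 := knotVal x i (k - 1) * knotVal y j (l - 1)
  set v10 := knotVal x i k * knotVal y j (l - 1)
  set v01 := knotVal x i (k - 1) * knotVal y j l
  set v11 := knotVal x i k * knotVal y j l
  set eS := midCoef i k * knotVal y j (l - 1)
  set eN := midCoef i k * knotVal y j l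
  set eE := knotVal x i k * midCoef j l
  set eW := knotVal x i (k - 1) * midCoef j l
  have t00 : 0 ≤ v00 * p00 ^ 2 := by positivity
  have t10 : 0 ≤ v10 * p10 ^ 2 := by positivity
  have t01 : 0 ≤ v01 * p01 ^ 2 := by positivity
  have t11 : 0 ≤ v11 * p11 ^ 2 := by positivity
  have tm : 0 ≤ 2 * (eS * (p00 * p10) + eE * (p10 * p11) + eN * (p01 * p11) + eW * (p00 * p01)) := by
    positivity
  have td : 0 ≤ 2 * q * ((eS + eW) / 2 * p00 + (eS + eE) / 2 * p10 + (eN + eW) / 2 * p01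
        + (eN + eE) / 2 * p11) := by positivity
  have tq : 0 ≤ (eS + eE + eN + eW) / 4 * q ^ 2 := by positivity
  rcases h with ⟨hv, hp⟩ | ⟨hv, hp⟩ | ⟨hv, hp⟩ | ⟨hv, hp⟩ | ⟨hv, ⟨hu, hu'⟩, hw, hw'⟩
  · have := mul_pos hv (pow_pos (by linarith : 0 < p00) 2)
    linarith
  · have := mul_pos hv (pow_pos (by linarith : 0 < p10) 2)
    linarith
  · have := mul_pos hv (pow_pos (by linarith : 0 < p01) 2)
    linarith
  · have := mul_pos hv (pow_pos (by linarith : 0 < p11) 2)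
    linarith
  · have hmax : max |u - 1 / 2| |w - 1 / 2| < 1 / 2 :=
      max_lt (abs_lt.2 ⟨by linarith, by linarith⟩) (abs_lt.2 ⟨by linarith, by linarith⟩)
    have hqp : 0 < q := by
      rw [hq']
      exact lt_max_of_lt_right (by linarith)
    have := mul_pos (by linarith : 0 < (eS + eE + eN + eW) / 4) (pow_pos hqp 2)
    linarith

/-- The octagon without its boundary. -/
def openOctagon (x y : ℤ → ℝ) (i j : ℤ) : Set (ℝ × ℝ) :=
  {z | x (i - 2) < z.1 ∧ z.1 < x (i + 1) ∧ y (j - 2) < z.2 ∧ z.2 < y (j + 1) ∧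
    1 < (z.1 - x (i - 2)) / step x (i - 1) + (z.2 - y (j - 2)) / step y (j - 1) ∧
    1 < (x (i + 1) - z.1) / step x (i + 1) + (z.2 - y (j - 2)) / step y (j - 1) ∧
    1 < (z.1 - x (i - 2)) / step x (i - 1) + (y (j + 1) - z.2) / step y (j + 1) ∧
    1 < (x (i + 1) - z.1) / step x (i + 1) + (y (j + 1) - z.2) / step y (j + 1)}

theorem coord_pred (x : ℤ → ℝ) (i : ℤ) (t : ℝ) :
    (t - x (i - 2)) / step x (i - 1) = coord x (i - 1) t := by
  rw [coord, sub_sub, one_add_one_eq_two]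

theorem coord_succ {x : ℤ → ℝ} (hx : IsKnots x) (i : ℤ) (t : ℝ) :
    (x (i + 1) - t) / step x (i + 1) = 1 - coord x (i + 1) t := by
  have := hx.step_pos (i + 1)
  rw [coord, div_eq_iff this.ne', sub_mul, div_mul_cancel₀ _ this.ne', step]
  ring

theorem isClosed_octagon (x y : ℤ → ℝ) (i j : ℤ) : IsClosed (octagon x y i j) := by
  have h : ∀ f g : ℝ × ℝ → ℝ, Continuous f → Continuous g → IsClosed {z | f z ≤ g z} :=
    fun f g hf hg => isClosed_le hf hg
  unfold octagon
  refine (h _ _ ?_ ?_).inter <| (h _ _ ?_ ?_).inter <| (h _ _ ?_ ?_).inter <|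
    (h _ _ ?_ ?_).inter <| (h _ _ ?_ ?_).inter <| (h _ _ ?_ ?_).inter <|
    (h _ _ ?_ ?_).inter (h _ _ ?_ ?_) <;> fun_prop

/-- All the defining inequalities are strict at the center of the middle rectangle. Moving a point
of the octagon towards that center makes them strict, and letting the displacement tend to 0
recovers the point. -/
theorem octagon_subset_closure {x y : ℤ → ℝ} (hx : IsKnots x) (hy : IsKnots y) (i j : ℤ) :
    octagon x y i j ⊆ closure (openOctagon x y i j) := by
  rintro ⟨s, t⟩ ⟨h₁, h₂, h₃, h₄, h₅, h₆, h₇, h₈⟩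
  dsimp only at h₁ h₂ h₃ h₄ h₅ h₆ h₇ h₈
  have aux : ∀ {r A B b : ℝ}, 0 < r → r ≤ 1 → b ≤ A → b < B → b < (1 - r) * A + r * B := by
    intro r A B b hr hr' hA hB
    nlinarith [mul_nonneg (sub_nonneg.2 hr') (sub_nonneg.2 hA), mul_pos hr (sub_pos.2 hB)]
  have add_gt : ∀ {A B : ℝ}, 1 < A → 1 < B → 1 < A + B := fun hA hB => by linarith
  have hmem : ∀ r : ℝ, r ∈ Set.Ioc (0 : ℝ) 1 →
      ((1 - r) * s + r * mid x i, (1 - r) * t + r * mid y j) ∈ openOctagon x y i j := by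
    rintro r ⟨hr, hr'⟩
    -- At the center each of the two fractions in a corner inequality already exceeds 1 by itself.
    have hm : ∀ {x : ℤ → ℝ}, IsKnots x → ∀ i : ℤ, x (i - 2) < mid x i ∧ mid x i < x (i + 1) ∧
        1 < (mid x i - x (i - 2)) / step x (i - 1) ∧
        1 < (x (i + 1) - mid x i) / step x (i + 1) := by
      intro x hx i
      have e₁ := hx.step_pos (i - 1)
      have e₂ := hx.step_pos i
      have e₃ := hx.step_pos (i + 1)
      rw [lt_div_iff₀ e₁, lt_div_iff₀ e₃]
      simp only [step, mid, sub_sub, one_add_one_eq_two, add_sub_cancel_right] at *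
      exact ⟨by linarith, by linarith, by linarith, by linarith⟩
    obtain ⟨a₁, a₂, a₃, a₄⟩ := hm hx i
    obtain ⟨b₁, b₂, b₃, b₄⟩ := hm hy j
    refine ⟨?_, ?_, ?_, ?_, ?_, ?_, ?_, ?_⟩
    · exact aux hr hr' h₁ a₁
    · exact neg_lt_neg_iff.1 ((aux hr hr' (neg_le_neg h₂) (neg_lt_neg a₂)).trans_eq (by ring))
    · exact aux hr hr' h₃ b₁
    · exact neg_lt_neg_iff.1 ((aux hr hr' (neg_le_neg h₄) (neg_lt_neg b₂)).trans_eq (by ring))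
    · exact (aux hr hr' h₅ (add_gt a₃ b₃)).trans_eq (by ring)
    · exact (aux hr hr' h₆ (add_gt a₄ b₃)).trans_eq (by ring)
    · exact (aux hr hr' h₇ (add_gt a₃ b₄)).trans_eq (by ring)
    · exact (aux hr hr' h₈ (add_gt a₄ b₄)).trans_eq (by ring)
  have hc : Continuous fun r : ℝ => ((1 - r) * s + r * mid x i, (1 - r) * t + r * mid y j) := by
    fun_prop
  have hlim := (hc.tendsto 0).mono_left (nhdsWithin_le_nhds (s := Set.Ioi (0 : ℝ)))
  simp only [sub_zero, one_mul, zero_mul, add_zero] at hlim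
  refine mem_closure_of_tendsto hlim ?_
  filter_upwards [Ioc_mem_nhdsGT (zero_lt_one (α := ℝ))] with r hr using hmem r hr

theorem IsKnots.coord_nonneg {x : ℤ → ℝ} (hx : IsKnots x) {k : ℤ} {t : ℝ} (h : x (k - 1) ≤ t) :
    0 ≤ coord x k t :=
  div_nonneg (sub_nonneg.2 h) (hx.step_pos k).le

theorem IsKnots.coord_pos {x : ℤ → ℝ} (hx : IsKnots x) {k : ℤ} {t : ℝ} (h : x (k - 1) < t) :
    0 < coord x k t :=
  div_pos (sub_pos.2 h) (hx.step_pos k)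

theorem IsKnots.coord_le_one {x : ℤ → ℝ} (hx : IsKnots x) {k : ℤ} {t : ℝ} (h : t ≤ x k) :
    coord x k t ≤ 1 := by
  rw [coord, div_le_one (hx.step_pos k), step]
  linarith

theorem IsKnots.coord_lt_one {x : ℤ → ℝ} (hx : IsKnots x) {k : ℤ} {t : ℝ} (h : t < x k) :
    coord x k t < 1 := by
  rw [coord, div_lt_one (hx.step_pos k), step]
  linarith

theorem IsKnots.one_le_coord {x : ℤ → ℝ} (hx : IsKnots x) {k : ℤ} {t : ℝ} (h : x k ≤ t) :
    1 ≤ coord x k t := by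
  rw [coord, one_le_div (hx.step_pos k), step]
  linarith

theorem IsKnots.coord_nonpos {x : ℤ → ℝ} (hx : IsKnots x) {k : ℤ} {t : ℝ} (h : t ≤ x (k - 1)) :
    coord x k t ≤ 0 :=
  div_nonpos_of_nonpos_of_nonneg (sub_nonpos.2 h) (hx.step_pos k).le

/-- In a corner rectangle of the 3 × 3 block only the coefficient at the vertex facing the middle
survives, so the patch is a multiple of the truncated square of the linear form that cuts the
corner. Elsewhere in the block the corner inequality holds since one of its terms is at least 1. -/
theorem mem_octagon_of_bspline_ne_zero {x y : ℤ → ℝ} (hx : IsKnots x) (hy : IsKnots y) {i j : ℤ}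
    {z : ℝ × ℝ} (h : bspline x y i j z ≠ 0) : z ∈ octagon x y i j := by
  have hact : (i, j) ∈ activeIndices x y z := by
    by_contra h'
    exact h (bspline_eq_zero_of_notMem (ij := (i, j)) hx hy h')
  rw [bspline_eq_patch hx hy] at h
  have hx₁ := hx.index_le z.1
  have hx₂ := hx.lt_index z.1
  have hy₁ := hy.index_le z.2
  have hy₂ := hy.lt_index z.2
  simp only [activeIndices, Finset.mem_product, Finset.mem_Icc] at hact
  set k := knotIndex x z.1
  set l := knotIndex y z.2
  obtain ⟨⟨a₁, a₂⟩, b₁, b₂⟩ := hact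
  have mx := hx.strictMono.monotone
  have my := hy.strictMono.monotone
  have c₁ : x (i - 2) ≤ z.1 := (mx (by omega)).trans hx₁
  have c₂ : z.1 ≤ x (i + 1) := hx₂.le.trans (mx (by omega))
  have c₃ : y (j - 2) ≤ z.2 := (my (by omega)).trans hy₁
  have c₄ : z.2 ≤ y (j + 1) := hy₂.le.trans (my (by omega))
  have d₁ : 0 ≤ coord x (i - 1) z.1 := hx.coord_nonneg (by rwa [sub_sub, one_add_one_eq_two])
  have d₂ : coord x (i + 1) z.1 ≤ 1 := hx.coord_le_one c₂
  have d₃ : 0 ≤ coord y (j - 1) z.2 := hy.coord_nonneg (by rwa [sub_sub, one_add_one_eq_two])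
  have d₄ : coord y (j + 1) z.2 ≤ 1 := hy.coord_le_one c₄
  have e₁ : i ≤ k → 1 ≤ coord x (i - 1) z.1 := fun hk => hx.one_le_coord ((mx (by omega)).trans hx₁)
  have e₂ : k ≤ i → coord x (i + 1) z.1 ≤ 0 := fun hk =>
    hx.coord_nonpos (hx₂.le.trans (mx (by omega)))
  have e₃ : j ≤ l → 1 ≤ coord y (j - 1) z.2 := fun hk => hy.one_le_coord ((my (by omega)).trans hy₁)
  have e₄ : l ≤ j → coord y (j + 1) z.2 ≤ 0 := fun hk =>
    hy.coord_nonpos (hy₂.le.trans (my (by omega)))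
  have kx := fun m hm => knotVal_eq_zero x (i := i) (k := m) hm
  have ky := fun m hm => knotVal_eq_zero y (i := j) (k := m) hm
  have hmax : ∀ {c p : ℝ}, c * max 0 p ^ 2 ≠ 0 → 0 < p := by
    intro c p hcp
    by_contra! hp
    exact hcp (by rw [max_eq_left hp]; ring)
  refine ⟨c₁, c₂, c₃, c₄, ?_⟩
  rw [coord_pred, coord_pred, coord_succ hx, coord_succ hy]
  refine ⟨?_, ?_, ?_, ?_⟩
  · by_cases hk : i ≤ k
    · linarith [e₁ hk]
    by_cases hl : j ≤ l
    · linarith [e₃ hl]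
    have hk' : k = i - 1 := by omega
    have hl' : l = j - 1 := by omega
    rw [hk', hl', patch, kx (i - 1 - 1) (by omega), ky (j - 1 - 1) (by omega),
      midCoef_eq_zero (by omega : i - 1 ≠ i), midCoef_eq_zero (by omega : j - 1 ≠ j)] at h
    simp only [zero_mul, mul_zero, add_zero, zero_add, zero_div] at h
    have := hmax h
    rw [← coord, ← coord] at this
    linarith
  · by_cases hk : k ≤ i
    · linarith [e₂ hk]
    by_cases hl : j ≤ l
    · linarith [e₃ hl]
    have hk' : k = i + 1 := by omega
    have hl' : l = j - 1 := by omega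
    rw [hk', hl', patch, kx (i + 1) (by omega), ky (j - 1 - 1) (by omega),
      midCoef_eq_zero (by omega : i + 1 ≠ i), midCoef_eq_zero (by omega : j - 1 ≠ j)] at h
    simp only [zero_mul, mul_zero, add_zero, zero_add, zero_div] at h
    have := hmax h
    rw [← coord, ← coord] at this
    linarith
  · by_cases hk : i ≤ k
    · linarith [e₁ hk]
    by_cases hl : l ≤ j
    · linarith [e₄ hl]
    have hk' : k = i - 1 := by omega
    have hl' : l = j + 1 := by omega
    rw [hk', hl', patch, kx (i - 1 - 1) (by omega), ky (j + 1) (by omega),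
      midCoef_eq_zero (by omega : i - 1 ≠ i), midCoef_eq_zero (by omega : j + 1 ≠ j)] at h
    simp only [zero_mul, mul_zero, add_zero, zero_add, zero_div] at h
    have := hmax h
    rw [← coord, ← coord] at this
    linarith
  · by_cases hk : k ≤ i
    · linarith [e₂ hk]
    by_cases hl : l ≤ j
    · linarith [e₄ hl]
    have hk' : k = i + 1 := by omega
    have hl' : l = j + 1 := by omega
    rw [hk', hl', patch, kx (i + 1) (by omega), ky (j + 1) (by omega),
      midCoef_eq_zero (by omega : i + 1 ≠ i), midCoef_eq_zero (by omega : j + 1 ≠ j)] at h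
    simp only [zero_mul, mul_zero, add_zero, zero_div] at h
    have := hmax h
    rw [← coord, ← coord] at this
    linarith

theorem bspline_pos_of_mem_openOctagon {x y : ℤ → ℝ} (hx : IsKnots x) (hy : IsKnots y) {i j : ℤ}
    {z : ℝ × ℝ} (h : z ∈ openOctagon x y i j) : 0 < bspline x y i j z := by
  obtain ⟨c₁, c₂, c₃, c₄, h⟩ := h
  rw [coord_pred, coord_pred, coord_succ hx, coord_succ hy] at h
  obtain ⟨d₁, d₂, d₃, d₄⟩ := h
  rw [bspline_eq_patch hx hy]
  have hx₁ := hx.index_le z.1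
  have hx₂ := hx.lt_index z.1
  have hy₁ := hy.index_le z.2
  have hy₂ := hy.lt_index z.2
  set k := knotIndex x z.1
  set l := knotIndex y z.2
  have k₁ := hx.strictMono.lt_iff_lt.1 (c₁.trans hx₂)
  have k₂ := hx.strictMono.lt_iff_lt.1 (hx₁.trans_lt c₂)
  have l₁ := hy.strictMono.lt_iff_lt.1 (c₃.trans hy₂)
  have l₂ := hy.strictMono.lt_iff_lt.1 (hy₁.trans_lt c₄)
  have u₀ := hx.coord_nonneg hx₁
  have u₁ := hx.coord_lt_one hx₂
  have w₀ := hy.coord_nonneg hy₁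
  have w₁ := hy.coord_lt_one hy₂
  have vx := fun m hm => knotVal_pos hx (i := i) (k := m) hm
  have vy := fun m hm => knotVal_pos hy (i := j) (k := m) hm
  have nx := knotVal_nonneg hx i
  have ny := knotVal_nonneg hy j
  have nm := midCoef_nonneg
  apply patch_pos hx hy
  have hk : k = i - 1 ∨ k = i ∨ k = i + 1 := by omega
  have hl : l = j - 1 ∨ l = j ∨ l = j + 1 := by omega
  have ux : k = i - 1 → 0 < coord x k z.1 := fun hk => hx.coord_pos (by
    rwa [hk, sub_sub, one_add_one_eq_two])
  have wy : l = j - 1 → 0 < coord y l z.2 := fun hl => hy.coord_pos (by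
    rwa [hl, sub_sub, one_add_one_eq_two])
  have sumx : k = i → 0 < midCoef i k * knotVal y j (l - 1) + knotVal x i k * midCoef j l
        + midCoef i k * knotVal y j l + knotVal x i (k - 1) * midCoef j l := by
    intro hk
    rw [hk, midCoef_self]
    have : 0 < knotVal y j (l - 1) + knotVal y j l := by
      rcases hl with h | h | h
      · exact add_pos_of_nonneg_of_pos (ny _) (vy _ (by omega))
      · exact add_pos_of_nonneg_of_pos (ny _) (vy _ (by omega))
      · exact add_pos_of_pos_of_nonneg (vy _ (by omega)) (ny _)
    linarith [mul_nonneg (nx i) (nm j l), mul_nonneg (nx (i - 1)) (nm j l)]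
  have sumy : l = j → 0 < midCoef i k * knotVal y j (l - 1) + knotVal x i k * midCoef j l
        + midCoef i k * knotVal y j l + knotVal x i (k - 1) * midCoef j l := by
    intro hl
    rw [hl, midCoef_self]
    have : 0 < knotVal x i (k - 1) + knotVal x i k := by
      rcases hk with h | h | h
      · exact add_pos_of_nonneg_of_pos (nx _) (vx _ (by omega))
      · exact add_pos_of_nonneg_of_pos (nx _) (vx _ (by omega))
      · exact add_pos_of_pos_of_nonneg (vx _ (by omega)) (nx _)
    linarith [mul_nonneg (nm i k) (ny j), mul_nonneg (nm i k) (ny (j - 1))]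
  -- In the middle row or column, off the left and bottom sides, the positive coefficient at the
  -- rectangle's center suffices. What is left are the corner rectangles and points on those two
  -- sides, where a positive vertex coefficient is found.
  by_cases hq : (k = i ∨ l = j) ∧ 0 < coord x k z.1 ∧ 0 < coord y l z.2
  · exact .inr <| .inr <| .inr <| .inr ⟨hq.1.elim sumx sumy, ⟨hq.2.1, u₁⟩, hq.2.2, w₁⟩
  rcases hk with hk | hk | hk <;> rcases hl with hl | hl | hl
  · exact .inr <| .inr <| .inr <| .inl
      ⟨mul_pos (vx _ (by omega)) (vy _ (by omega)), by rw [hk, hl]; linarith⟩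
  · exact .inr <| .inl ⟨mul_pos (vx _ (by omega)) (vy _ (by omega)), by
      by_contra! hc
      exact hq ⟨.inr hl, ux hk, (ux hk).trans_le hc⟩⟩
  · exact .inr <| .inl
      ⟨mul_pos (vx _ (by omega)) (vy _ (by omega)), by rw [hk, hl]; linarith⟩
  · exact .inr <| .inr <| .inl ⟨mul_pos (vx _ (by omega)) (vy _ (by omega)), by
      by_contra! hc
      exact hq ⟨.inl hk, (wy hl).trans_le hc, wy hl⟩⟩
  · exact .inl ⟨mul_pos (vx _ (by omega)) (vy _ (by omega)), by
      by_contra! hc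
      exact hq ⟨.inl hk, by linarith, by linarith⟩⟩
  · exact .inl ⟨mul_pos (vx _ (by omega)) (vy _ (by omega)), by
      by_contra! hc
      exact hq ⟨.inl hk, by linarith, by linarith⟩⟩
  · exact .inr <| .inr <| .inl
      ⟨mul_pos (vx _ (by omega)) (vy _ (by omega)), by rw [hk, hl]; linarith⟩
  · exact .inl ⟨mul_pos (vx _ (by omega)) (vy _ (by omega)), by
      by_contra! hc
      exact hq ⟨.inr hl, by linarith, by linarith⟩⟩
  · exact .inl
      ⟨mul_pos (vx _ (by omega)) (vy _ (by omega)), by rw [hk, hl]; linarith⟩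

theorem tsupport_bspline {x y : ℤ → ℝ} (hx : IsKnots x) (hy : IsKnots y) (i j : ℤ) :
    tsupport (bspline x y i j) = octagon x y i j := by
  refine Set.Subset.antisymm (closure_minimal (fun z hz => mem_octagon_of_bspline_ne_zero hx hy hz)
    (isClosed_octagon x y i j)) ((octagon_subset_closure hx hy i j).trans (closure_mono ?_))
  exact fun z hz => (bspline_pos_of_mem_openOctagon hx hy hz).ne'

/-! ### Moments of symmetric kernels -/

theorem map_volume_sub_div (s : ℝ) {h : ℝ} (hh : h ≠ 0) :
    Measure.map (fun t : ℝ => (t - s) / h) volume = ENNReal.ofReal |h| • volume := by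
  have h₁ : (fun t : ℝ => (t - s) / h) = (fun t => t * h⁻¹) ∘ fun t => t - s := by
    ext t
    simp [div_eq_mul_inv]
  rw [h₁, ← Measure.map_map (by fun_prop) (by fun_prop), (measurePreserving_sub_right _ s).map_eq,
    Real.map_volume_mul_right (inv_ne_zero hh), inv_inv]

/-- The map to the coordinates centered at `c` with scales `h`, `k`. -/
noncomputable def rescale (c : ℝ × ℝ) (h k : ℝ) (z : ℝ × ℝ) : ℝ × ℝ :=
  ((z.1 - c.1) / h, (z.2 - c.2) / k)

section Rescale

variable (c : ℝ × ℝ) {h k : ℝ} (hh : h ≠ 0) (hk : k ≠ 0)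
include hh hk

theorem map_rescale :
    Measure.map (rescale c h k) volume = ENNReal.ofReal |h * k| • volume := by
  have h₁ : rescale c h k = Prod.map (fun t => (t - c.1) / h) fun t => (t - c.2) / k := rfl
  rw [Measure.volume_eq_prod, h₁, ← Measure.map_prod_map _ _ (by fun_prop) (by fun_prop),
    map_volume_sub_div _ hh, map_volume_sub_div _ hk, Measure.prod_smul_left,
    Measure.prod_smul_right, smul_smul, abs_mul, ENNReal.ofReal_mul (abs_nonneg _)]

theorem measurableEmbedding_rescale : MeasurableEmbedding (rescale c h k) := by
  have hr : Function.LeftInverse (fun w : ℝ × ℝ => (w.1 * h + c.1, w.2 * k + c.2))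
      (rescale c h k) := by
    rintro ⟨s, t⟩
    simp [rescale, hh, hk]
  have hl : Function.RightInverse (fun w : ℝ × ℝ => (w.1 * h + c.1, w.2 * k + c.2))
      (rescale c h k) := by
    rintro ⟨s, t⟩
    simp [rescale, hh, hk]
  have hm : Measurable (rescale c h k) := by
    unfold rescale
    fun_prop
  exact (MeasurableEquiv.mk ⟨rescale c h k, _, hr, hl⟩ hm (by simp; fun_prop)).measurableEmbedding

theorem integral_rescale (F : ℝ × ℝ → ℝ) :
    ∫ z, F (rescale c h k z) = |h * k| * ∫ z, F z := by
  rw [← (measurableEmbedding_rescale c hh hk).integral_map, map_rescale c hh hk,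
    integral_smul_measure, ENNReal.toReal_ofReal (abs_nonneg _), smul_eq_mul]

theorem integrable_rescale {F : ℝ × ℝ → ℝ} (hF : Integrable F) :
    Integrable fun z => F (rescale c h k z) := by
  refine ((measurableEmbedding_rescale c hh hk).integrable_map_iff (g := F)).1 ?_
  rw [map_rescale c hh hk]
  exact hF.smul_measure ENNReal.ofReal_ne_top

end Rescale

/-- The function is integrable with the given integral. -/
structure HasIntegral (f : ℝ × ℝ → ℝ) (r : ℝ) : Prop where
  integrable : Integrable f
  integral_eq : ∫ z, f z = r

theorem HasIntegral.add {f g : ℝ × ℝ → ℝ} {r s : ℝ} (hf : HasIntegral f r)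
    (hg : HasIntegral g s) : HasIntegral (fun z => f z + g z) (r + s) :=
  ⟨hf.integrable.add hg.integrable, by
    rw [integral_add hf.integrable hg.integrable, hf.integral_eq, hg.integral_eq]⟩

theorem HasIntegral.const_mul {f : ℝ × ℝ → ℝ} {r : ℝ} (hf : HasIntegral f r) (c : ℝ) :
    HasIntegral (fun z => c * f z) (c * r) :=
  ⟨hf.integrable.const_mul c, by rw [integral_const_mul, hf.integral_eq]⟩

/-- Nonnegative kernels on the unit square centered at the origin, with the symmetries of the
square, mean value `1`, and with variance `σ` in each variable. -/
structure IsKernel (ω : ℝ × ℝ → ℝ) (σ : ℝ) : Prop where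
  measurable : Measurable ω
  nonneg : ∀ z, 0 ≤ ω z
  bounded : ∃ C, ∀ z, ω z ≤ C
  eq_zero : ∀ z, 1 / 2 < |z.1| → ω z = 0
  even : ∀ s t, ω (-s, t) = ω (s, t)
  swap : ∀ s t, ω (t, s) = ω (s, t)
  marginal : ∃ m : ℝ → ℝ, (∀ s, |s| ≤ 1 / 2 → ∫ t, ω (s, t) = m s) ∧
    (∫ s in (-(1 / 2 : ℝ))..(1 / 2), m s = 1) ∧ ∫ s in (-(1 / 2 : ℝ))..(1 / 2), s ^ 2 * m s = σ

section Kernel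

variable {ω : ℝ × ℝ → ℝ} {σ : ℝ}

theorem IsKernel.eq_zero_of_notMem (hω : IsKernel ω σ) {z : ℝ × ℝ}
    (hz : z ∉ Set.Icc (-(1 / 2 : ℝ)) (1 / 2) ×ˢ Set.Icc (-(1 / 2 : ℝ)) (1 / 2)) : ω z = 0 := by
  obtain ⟨s, t⟩ := z
  by_cases hs : |s| ≤ 1 / 2
  · by_cases ht : |t| ≤ 1 / 2
    · exact absurd ⟨abs_le.1 hs, abs_le.1 ht⟩ hz
    · rw [← hω.swap]
      exact hω.eq_zero _ (not_le.1 ht)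
  · exact hω.eq_zero _ (not_le.1 hs)

theorem IsKernel.integrable_mul (hω : IsKernel ω σ) {g : ℝ × ℝ → ℝ} (hg : Continuous g) :
    Integrable fun z => g z * ω z := by
  set S : Set (ℝ × ℝ) := Set.Icc (-(1 / 2 : ℝ)) (1 / 2) ×ˢ Set.Icc (-(1 / 2 : ℝ)) (1 / 2)
  have hS : IsCompact S := isCompact_Icc.prod isCompact_Icc
  obtain ⟨C, hC⟩ := hω.bounded
  have h₁ : Integrable (S.indicator g) :=
    (hg.continuousOn.integrableOn_compact hS).integrable_indicator hS.measurableSet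
  have h₂ := h₁.mul_bdd (c := C) hω.measurable.aestronglyMeasurable
    (Eventually.of_forall fun z => by
      rw [Real.norm_eq_abs, abs_of_nonneg (hω.nonneg z)]
      exact hC z)
  refine h₂.congr (Eventually.of_forall fun z => ?_)
  by_cases hz : z ∈ S
  · simp only [Set.indicator_of_mem hz]
  · simp only [hω.eq_zero_of_notMem hz, mul_zero]

theorem IsKernel.integral_fst (hω : IsKernel ω σ) {g : ℝ → ℝ} (hg : Continuous g) {m : ℝ → ℝ}
    (hm : ∀ s, |s| ≤ 1 / 2 → ∫ t, ω (s, t) = m s) :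
    ∫ z, g z.1 * ω z = ∫ s in (-(1 / 2 : ℝ))..(1 / 2), g s * m s := by
  have hint := hω.integrable_mul (hg.comp continuous_fst)
  rw [Measure.volume_eq_prod] at hint ⊢
  refine (integral_prod _ hint).trans ?_
  simp only [Function.comp_apply, integral_const_mul]
  rw [intervalIntegral.integral_of_le (by norm_num), ← integral_Icc_eq_integral_Ioc]
  rw [← setIntegral_eq_integral_of_forall_compl_eq_zero (s := Set.Icc (-(1 / 2 : ℝ)) (1 / 2))]
  · refine setIntegral_congr_fun measurableSet_Icc fun s hs => ?_
    simp only [hm s (abs_le.2 hs)]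
  · intro s hs
    have h₀ : ∀ t, ω (s, t) = 0 := fun t => hω.eq_zero_of_notMem fun h => hs h.1
    simp [h₀]

theorem IsKernel.integral_swap (hω : IsKernel ω σ) (F : ℝ × ℝ → ℝ) :
    ∫ z, F z * ω z = ∫ z, F z.swap * ω z := by
  rw [Measure.volume_eq_prod, ← integral_prod_swap]
  refine integral_congr_ae (Eventually.of_forall fun z => ?_)
  simp only [Prod.swap, hω.swap]

/-- The reflection of the first coordinate is `rescale` with scales -1 and 1; it preserves the
integral and changes its sign. -/
theorem IsKernel.integral_eq_zero_of_odd (hω : IsKernel ω σ) {F : ℝ × ℝ → ℝ}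
    (hF : ∀ s t, F (-s, t) = -F (s, t)) : ∫ z, F z * ω z = 0 := by
  have h := integral_rescale (0, 0) (h := -1) (k := 1) (by norm_num) one_ne_zero
    fun z => F z * ω z
  have h' : ∀ z : ℝ × ℝ, F (rescale (0, 0) (-1) 1 z) * ω (rescale (0, 0) (-1) 1 z)
      = -(F z * ω z) := by
    rintro ⟨s, t⟩
    simp [rescale, div_neg, hF, hω.even]
  simp only [h', integral_neg] at h
  norm_num at h
  linarith

theorem IsKernel.integral_quadratic (hω : IsKernel ω σ) (c₀ c₁ c₂ c₃ c₄ c₅ : ℝ) :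
    ∫ z : ℝ × ℝ, (c₀ + c₁ * z.1 + c₂ * z.2 + c₃ * z.1 ^ 2 + c₄ * (z.1 * z.2) + c₅ * z.2 ^ 2) * ω z
      = c₀ + σ * (c₃ + c₅) := by
  obtain ⟨m, hm, hm₀, hm₂⟩ := hω.marginal
  have i₀ : ∫ z, (1 : ℝ) * ω z = 1 := by
    rw [hω.integral_fst continuous_const hm]
    simpa using hm₀
  have i₁ : ∫ z : ℝ × ℝ, z.1 * ω z = 0 := hω.integral_eq_zero_of_odd fun s t => rfl
  have i₂ : ∫ z : ℝ × ℝ, z.2 * ω z = 0 := by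
    rw [hω.integral_swap]
    exact i₁
  have i₃ : ∫ z : ℝ × ℝ, z.1 ^ 2 * ω z = σ := by
    rw [hω.integral_fst (g := fun s => s ^ 2) (by fun_prop) hm, hm₂]
  have i₄ : ∫ z : ℝ × ℝ, (z.1 * z.2) * ω z = 0 :=
    hω.integral_eq_zero_of_odd fun s t => neg_mul _ _
  have i₅ : ∫ z : ℝ × ℝ, z.2 ^ 2 * ω z = σ := by
    rw [hω.integral_swap]
    exact i₃
  have n₀ := HasIntegral.const_mul ⟨hω.integrable_mul (g := fun _ => 1) (by fun_prop), i₀⟩ c₀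
  have n₁ := HasIntegral.const_mul ⟨hω.integrable_mul (g := fun z => z.1) (by fun_prop), i₁⟩ c₁
  have n₂ := HasIntegral.const_mul ⟨hω.integrable_mul (g := fun z => z.2) (by fun_prop), i₂⟩ c₂
  have n₃ := HasIntegral.const_mul ⟨hω.integrable_mul (g := fun z => z.1 ^ 2) (by fun_prop), i₃⟩ c₃
  have n₄ := HasIntegral.const_mul ⟨hω.integrable_mul (g := fun z => z.1 * z.2) (by fun_prop), i₄⟩ c₄
  have n₅ := HasIntegral.const_mul ⟨hω.integrable_mul (g := fun z => z.2 ^ 2) (by fun_prop), i₅⟩ c₅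
  have := (((((n₀.add n₁).add n₂).add n₃).add n₄).add n₅).integral_eq
  refine (integral_congr_ae (Eventually.of_forall fun z => ?_)).trans (this.trans ?_)
  · ring
  · ring

end Kernel

/-- The kernel of the mean values over rectangles. -/
noncomputable def boxKernel (z : ℝ × ℝ) : ℝ :=
  (Set.Icc (-(1 / 2 : ℝ)) (1 / 2) ×ˢ Set.Icc (-(1 / 2 : ℝ)) (1 / 2)).indicator (fun _ => 1) z

theorem boxKernel_apply (s t : ℝ) :
    boxKernel (s, t) = if |s| ≤ 1 / 2 ∧ |t| ≤ 1 / 2 then 1 else 0 := by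
  simp only [boxKernel, Set.indicator, Set.mem_prod, Set.mem_Icc, abs_le]

theorem isKernel_boxKernel : IsKernel boxKernel (1 / 12) where
  measurable := measurable_const.indicator (measurableSet_Icc.prod measurableSet_Icc)
  nonneg z := Set.indicator_nonneg (fun _ _ => zero_le_one) z
  bounded := ⟨1, fun z => Set.indicator_le' (fun _ _ => le_rfl) (fun _ _ => zero_le_one) z⟩
  eq_zero z hz := by
    rw [← Prod.mk.eta (p := z), boxKernel_apply, if_neg fun h => absurd h.1 (not_le.2 hz)]
  even s t := by simp only [boxKernel_apply, abs_neg]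
  swap s t := by simp only [boxKernel_apply, and_comm]
  marginal := by
    refine ⟨fun _ => 1, fun s hs => ?_, ?_, ?_⟩
    · have h : ∀ t, boxKernel (s, t) = (Set.Icc (-(1 / 2 : ℝ)) (1 / 2)).indicator (fun _ => 1) t := by
        intro t
        simp only [boxKernel_apply, hs, true_and, Set.indicator, Set.mem_Icc, abs_le]
      simp only [h]
      rw [integral_indicator measurableSet_Icc]
      simp
      norm_num
    · simp
      norm_num
    · simp
      norm_num

/-- The kernel of the weighted mean values given by the pyramids. -/
noncomputable def pyramidKernel (z : ℝ × ℝ) : ℝ := 3 * max 0 (1 - 2 * max |z.1| |z.2|)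

/-- By symmetry the integral is twice the one over `t > 0`. With `r = |s|`, the profile in `t` is
constant, equal to `1 - 2 * r`, up to `r`, then decreases linearly to 0 at 1/2. -/
theorem integral_pyramidKernel {s : ℝ} (hs : |s| ≤ 1 / 2) :
    ∫ t, pyramidKernel (s, t) = 3 / 2 * (1 - 4 * s ^ 2) := by
  simp only [pyramidKernel, integral_const_mul]
  rw [← sq_abs s]
  have h₀ := abs_nonneg s
  generalize |s| = r at *
  rw [integral_comp_abs (f := fun t => max 0 (1 - 2 * max r t)),
    setIntegral_eq_of_subset_of_forall_sdiff_eq_zero measurableSet_Ioi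
      (Set.Ioc_subset_Ioi_self : Set.Ioc (0 : ℝ) (1 / 2) ⊆ _)]
  · have hc : Continuous fun t : ℝ => max 0 (1 - 2 * max r t) := by fun_prop
    rw [← intervalIntegral.integral_of_le (by norm_num),
      ← intervalIntegral.integral_add_adjacent_intervals (hc.intervalIntegrable 0 r)
        (hc.intervalIntegrable r (1 / 2))]
    have h₁ : ∫ t in (0 : ℝ)..r, max 0 (1 - 2 * max r t) = ∫ t in (0 : ℝ)..r, (1 - 2 * r) := by
      refine intervalIntegral.integral_congr fun t ht => ?_
      rw [Set.uIcc_of_le h₀] at ht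
      rw [max_eq_left ht.2, max_eq_right (by linarith)]
    have h₂ : ∫ t in r..(1 / 2), max 0 (1 - 2 * max r t) = ∫ t in r..(1 / 2), (1 - 2 * t) := by
      refine intervalIntegral.integral_congr fun t ht => ?_
      rw [Set.uIcc_of_le hs] at ht
      rw [max_eq_right ht.1, max_eq_right (by linarith [ht.2])]
    have h₃ : ∫ t in r..(1 / 2 : ℝ), (1 - 2 * t) = (1 / 2 - r) - ((1 / 2) ^ 2 - r ^ 2) := by
      rw [intervalIntegral.integral_sub (by simp)
        ((by fun_prop : Continuous fun t : ℝ => 2 * t).intervalIntegrable _ _),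
        intervalIntegral.integral_const_mul, integral_id, intervalIntegral.integral_const,
        smul_eq_mul]
      ring
    rw [h₁, h₂, h₃, intervalIntegral.integral_const, smul_eq_mul]
    ring
  · rintro t ⟨ht, ht'⟩
    have : 1 / 2 < t := by
      by_contra! h
      exact ht' ⟨ht, h⟩
    have h₁ := le_max_right r t
    exact max_eq_left (by linarith)

theorem isKernel_pyramidKernel : IsKernel pyramidKernel (1 / 20) where
  measurable := by
    have : Continuous pyramidKernel := by
      unfold pyramidKernel
      fun_prop
    exact this.measurable
  nonneg z := mul_nonneg (by norm_num) (le_max_left _ _)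
  bounded := by
    refine ⟨3, fun z => ?_⟩
    have h : max 0 (1 - 2 * max |z.1| |z.2|) ≤ 1 :=
      max_le zero_le_one (by linarith [(abs_nonneg z.1).trans (le_max_left |z.1| |z.2|)])
    rw [pyramidKernel]
    linarith
  eq_zero z hz := by
    rw [pyramidKernel, max_eq_left (by linarith [le_max_left |z.1| |z.2|]), mul_zero]
  even s t := by simp only [pyramidKernel, abs_neg]
  swap s t := by simp only [pyramidKernel, max_comm]
  marginal := by
    have hc : ∀ n : ℕ, IntervalIntegrable (fun s : ℝ => s ^ n) volume (-(1 / 2)) (1 / 2) :=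
      fun n => (continuous_pow n).intervalIntegrable _ _
    have hp : ∀ n : ℕ, ∫ s in (-(1 / 2 : ℝ))..(1 / 2), s ^ n * (3 / 2 * (1 - 4 * s ^ 2))
        = 3 / 2 * (∫ s in (-(1 / 2 : ℝ))..(1 / 2), s ^ n)
          - 6 * ∫ s in (-(1 / 2 : ℝ))..(1 / 2), s ^ (n + 2) := by
      intro n
      rw [← intervalIntegral.integral_const_mul, ← intervalIntegral.integral_const_mul,
        ← intervalIntegral.integral_sub ((hc n).const_mul _) ((hc (n + 2)).const_mul _)]
      congr 1
      ext s
      ring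
    refine ⟨fun s => 3 / 2 * (1 - 4 * s ^ 2), fun s hs => integral_pyramidKernel hs, ?_, ?_⟩
    · have := hp 0
      simp only [pow_zero, one_mul] at this
      rw [this]
      simp
      norm_num
    · rw [hp 2, integral_pow, integral_pow]
      norm_num

/-! ### Mean value weights -/

/-- Families of nonnegative weights on the rectangles whose pairing with a quadratic polynomial is
the value at the center plus `σ` times the second differences. -/
structure IsMeanWeight (x y : ℤ → ℝ) (σ : ℝ) (K : ℤ → ℤ → ℝ × ℝ → ℝ) : Prop where
  nonneg : ∀ i j z, 0 ≤ K i j z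
  integrable : ∀ i j (g : ℝ × ℝ → ℝ), Continuous g → Integrable fun z => g z * K i j z
  integral_quadratic : ∀ i j (c₀ c₁ c₂ c₃ c₄ c₅ : ℝ),
    ∫ z : ℝ × ℝ, (c₀ + c₁ * z.1 + c₂ * z.2 + c₃ * z.1 ^ 2 + c₄ * (z.1 * z.2) + c₅ * z.2 ^ 2)
      * K i j z = c₀ + c₁ * mid x i + c₂ * mid y j + c₃ * (mid x i ^ 2 + σ * step x i ^ 2)
        + c₄ * (mid x i * mid y j) + c₅ * (mid y j ^ 2 + σ * step y j ^ 2)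

theorem IsKernel.isMeanWeight {x y : ℤ → ℝ} (hx : IsKnots x) (hy : IsKnots y) {ω : ℝ × ℝ → ℝ}
    {σ : ℝ} (hω : IsKernel ω σ) {K : ℤ → ℤ → ℝ × ℝ → ℝ}
    (hK : ∀ i j z, K i j z = 1 / (step x i * step y j)
      * ω (rescale (center x y i j) (step x i) (step y j) z)) : IsMeanWeight x y σ K where
  nonneg i j z := by
    rw [hK]
    have := hx.step_pos i
    have := hy.step_pos j
    have := hω.nonneg (rescale (center x y i j) (step x i) (step y j) z)
    positivity
  integrable i j g hg := by
    have h₁ := (hx.step_pos i).ne'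
    have h₂ := (hy.step_pos j).ne'
    have := integrable_rescale (center x y i j) h₁ h₂ (hω.integrable_mul
      (g := fun w => g (w.1 * step x i + mid x i, w.2 * step y j + mid y j)) (by fun_prop))
    refine (this.const_mul (1 / (step x i * step y j))).congr (Eventually.of_forall fun z => ?_)
    have e₁ : (rescale (center x y i j) (step x i) (step y j) z).1 * step x i + mid x i = z.1 := by
      simp [rescale, center, h₁]
    have e₂ : (rescale (center x y i j) (step x i) (step y j) z).2 * step y j + mid y j = z.2 := by
      simp [rescale, center, h₂]
    simp only [e₁, e₂, hK, Prod.mk.eta]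
    ring
  integral_quadratic i j c₀ c₁ c₂ c₃ c₄ c₅ := by
    have h₁ := (hx.step_pos i).ne'
    have h₂ := (hy.step_pos j).ne'
    have e₁ : ∀ z : ℝ × ℝ,
        z.1 = (rescale (center x y i j) (step x i) (step y j) z).1 * step x i + mid x i := by
      intro z
      simp [rescale, center, h₁]
    have e₂ : ∀ z : ℝ × ℝ,
        z.2 = (rescale (center x y i j) (step x i) (step y j) z).2 * step y j + mid y j := by
      intro z
      simp [rescale, center, h₂]
    set s := mid x i
    set t := mid y j
    set h := step x i
    set k := step y j
    -- These are the Taylor coefficients of the polynomial at the center, scaled by the steps.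
    have key := hω.integral_quadratic (c₀ + c₁ * s + c₂ * t + c₃ * s ^ 2 + c₄ * (s * t) + c₅ * t ^ 2)
      ((c₁ + 2 * c₃ * s + c₄ * t) * h) ((c₂ + 2 * c₅ * t + c₄ * s) * k) (c₃ * h ^ 2)
      (c₄ * (h * k)) (c₅ * k ^ 2)
    set Q : ℝ × ℝ → ℝ := fun w =>
      (c₀ + c₁ * s + c₂ * t + c₃ * s ^ 2 + c₄ * (s * t) + c₅ * t ^ 2
      + (c₁ + 2 * c₃ * s + c₄ * t) * h * w.1 + (c₂ + 2 * c₅ * t + c₄ * s) * k * w.2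
      + c₃ * h ^ 2 * w.1 ^ 2 + c₄ * (h * k) * (w.1 * w.2) + c₅ * k ^ 2 * w.2 ^ 2) * ω w with hQ
    have hsub := integral_rescale (center x y i j) h₁ h₂ Q
    rw [key, abs_of_pos (mul_pos (hx.step_pos i) (hy.step_pos j))] at hsub
    have hpt : ∀ z : ℝ × ℝ, (c₀ + c₁ * z.1 + c₂ * z.2 + c₃ * z.1 ^ 2 + c₄ * (z.1 * z.2)
        + c₅ * z.2 ^ 2) * K i j z = (h * k)⁻¹ * Q (rescale (center x y i j) h k z) := by
      intro z
      rw [hK]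
      have e₁ := e₁ z
      have e₂ := e₂ z
      change _ * (1 / (h * k) * ω (rescale (center x y i j) h k z)) = _
      generalize rescale (center x y i j) h k z = w at *
      rw [e₁, e₂]
      simp only [hQ]
      ring
    simp only [hpt, integral_const_mul]
    rw [hsub, inv_mul_cancel_left₀ (mul_ne_zero h₁ h₂)]
    ring

theorem isMeanWeight_pyramidN {x y : ℤ → ℝ} (hx : IsKnots x) (hy : IsKnots y) :
    IsMeanWeight x y (1 / 20) (pyramidN x y) := by
  refine isKernel_pyramidKernel.isMeanWeight hx hy fun i j z => ?_
  rw [pyramidN, pyramid, pyramidKernel]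
  simp only [rescale, center, abs_div, abs_of_pos (hx.step_pos i), abs_of_pos (hy.step_pos j)]
  ring

theorem isMeanWeight_chiN {x y : ℤ → ℝ} (hx : IsKnots x) (hy : IsKnots y) :
    IsMeanWeight x y (1 / 12) (chiN x y) := by
  refine isKernel_boxKernel.isMeanWeight hx hy fun i j z => ?_
  have hm : ∀ {x : ℤ → ℝ}, IsKnots x → ∀ (i : ℤ) (t : ℝ), (t ∈ Set.Icc (x (i - 1)) (x i)
      ↔ (t - mid x i) / step x i ∈ Set.Icc (-(1 / 2 : ℝ)) (1 / 2)) := by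
    intro x hx i t
    have h := hx.step_pos i
    rw [Set.mem_Icc, Set.mem_Icc, le_div_iff₀ h, div_le_iff₀ h, step, mid]
    constructor <;> rintro ⟨h₁, h₂⟩ <;> constructor <;> linarith
  rw [chiN, boxKernel]
  congr 1
  simp only [Set.indicator, rect, Set.mem_prod, rescale, center, hm hx, hm hy]

/-! ### Quasi-interpolants with five-point weights -/

/-- The operator `f ↦ ∑ ⟨f, w i j⟩ B i j`. -/
noncomputable def quasiInterp (x y : ℤ → ℝ) (w : ℤ → ℤ → ℝ × ℝ → ℝ) (f : ℝ × ℝ → ℝ) (z : ℝ × ℝ) : ℝ :=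
  ∑' ij : ℤ × ℤ, (∫ v : ℝ × ℝ, f v * w ij.1 ij.2 v) * bspline x y ij.1 ij.2 z

/-- The combination of the weights `K` at a rectangle and its four neighbours. -/
noncomputable def stencil (x y : ℤ → ℝ) (A A' : (ℤ → ℝ) → ℤ → ℝ) (K : ℤ → ℤ → ℝ × ℝ → ℝ) (i j : ℤ)
    (z : ℝ × ℝ) : ℝ :=
  A x i * K (i - 1) j z + A' x i * K (i + 1) j z
    + (1 - (A x i + A' x i + A y j + A' y j)) * K i j z
    + A y j * K i (j - 1) z + A' y j * K i (j + 1) z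

theorem T2_eq (x y : ℤ → ℝ) : T2 x y = quasiInterp x y (stencil x y a aBar (pyramidN x y)) := rfl

theorem G2_eq (x y : ℤ → ℝ) : G2 x y = quasiInterp x y (stencil x y alpha alphaBar (chiN x y)) := rfl

/-- Coefficients for which the stencil of weights with variance `σ` reproduces the B-spline
coefficients of quadratic polynomials. -/
structure IsExact (x : ℤ → ℝ) (σ : ℝ) (A A' : (ℤ → ℝ) → ℤ → ℝ) : Prop where
  -- The centers of the two neighbours lie at half of these sums to the left and to the right, so
  -- this cancels the first order terms.
  first : ∀ i, A x i * (step x (i - 1) + step x i) = A' x i * (step x i + step x (i + 1))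
  -- The mean of s² is `mid x i ^ 2 + σ * step x i ^ 2`, while the polar form is `mid x i ^ 2 - step
  -- x i ^ 2 / 4`; the neighbours must supply the difference.
  second : ∀ i, A x i * ((step x (i - 1) + step x i) ^ 2 / 4 + σ * (step x (i - 1) ^ 2 - step x i ^ 2))
    + A' x i * ((step x i + step x (i + 1)) ^ 2 / 4 + σ * (step x (i + 1) ^ 2 - step x i ^ 2))
    = -(1 / 4 + σ) * step x i ^ 2

section Exact

variable {x y : ℤ → ℝ} {σ : ℝ} {A A' : (ℤ → ℝ) → ℤ → ℝ} {K : ℤ → ℤ → ℝ × ℝ → ℝ}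

theorem mid_pred (x : ℤ → ℝ) (i : ℤ) :
    mid x (i - 1) = mid x i - (step x (i - 1) + step x i) / 2 := by
  simp only [mid, step]
  ring

theorem mid_succ (x : ℤ → ℝ) (i : ℤ) :
    mid x (i + 1) = mid x i + (step x i + step x (i + 1)) / 2 := by
  simp only [mid, step, add_sub_cancel_right]
  ring

theorem mul_knots (x : ℤ → ℝ) (i : ℤ) : x (i - 1) * x i = mid x i ^ 2 - step x i ^ 2 / 4 := by
  simp only [mid, step]
  ring

theorem IsMeanWeight.hasIntegral (hK : IsMeanWeight x y σ K) (i j : ℤ)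
    (c₀ c₁ c₂ c₃ c₄ c₅ : ℝ) : HasIntegral (fun z : ℝ × ℝ =>
      (c₀ + c₁ * z.1 + c₂ * z.2 + c₃ * z.1 ^ 2 + c₄ * (z.1 * z.2) + c₅ * z.2 ^ 2) * K i j z)
      (c₀ + c₁ * mid x i + c₂ * mid y j + c₃ * (mid x i ^ 2 + σ * step x i ^ 2)
        + c₄ * (mid x i * mid y j) + c₅ * (mid y j ^ 2 + σ * step y j ^ 2)) :=
  ⟨hK.integrable i j _ (by fun_prop), hK.integral_quadratic i j c₀ c₁ c₂ c₃ c₄ c₅⟩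

theorem IsMeanWeight.integral_stencil (hK : IsMeanWeight x y σ K) (hAx : IsExact x σ A A')
    (hAy : IsExact y σ A A') (i j : ℤ) (c₀ c₁ c₂ c₃ c₄ c₅ : ℝ) :
    ∫ z : ℝ × ℝ, (c₀ + c₁ * z.1 + c₂ * z.2 + c₃ * z.1 ^ 2 + c₄ * (z.1 * z.2) + c₅ * z.2 ^ 2)
      * stencil x y A A' K i j z
      = c₀ + c₁ * mid x i + c₂ * mid y j + c₃ * (x (i - 1) * x i)
        + c₄ * (mid x i * mid y j) + c₅ * (y (j - 1) * y j) := by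
  have h := fun i j => hK.hasIntegral i j c₀ c₁ c₂ c₃ c₄ c₅
  have key := ((((((h (i - 1) j).const_mul (A x i)).add ((h (i + 1) j).const_mul (A' x i))).add
    ((h i j).const_mul (1 - (A x i + A' x i + A y j + A' y j)))).add
      ((h i (j - 1)).const_mul (A y j))).add ((h i (j + 1)).const_mul (A' y j))).integral_eq
  refine (integral_congr_ae (Eventually.of_forall fun z => ?_)).trans (key.trans ?_)
  · simp only [stencil]
    ring
  · rw [mid_pred, mid_pred, mid_succ, mid_succ, mul_knots, mul_knots]
    -- Each neighbour moves only one coordinate of the center, so the mixed term enters through the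
    -- first order conditions alone.
    linear_combination -(c₁ + c₄ * mid y j + 2 * c₃ * mid x i) / 2 * hAx.first i
      + c₃ * hAx.second i - (c₂ + c₄ * mid x i + 2 * c₅ * mid y j) / 2 * hAy.first j
      + c₅ * hAy.second j

theorem quasiInterp_polyFun (hx : IsKnots x) (hy : IsKnots y) (hK : IsMeanWeight x y σ K)
    (hAx : IsExact x σ A A') (hAy : IsExact y σ A A') {p : MvPolynomial (Fin 2) ℝ}
    (hp : p.totalDegree ≤ 2) :
    quasiInterp x y (stencil x y A A' K) (polyFun p) = polyFun p := by
  obtain ⟨c₀, c₁, c₂, c₃, c₄, c₅, h⟩ := isQuadratic_polyFun hp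
  ext z
  simp only [quasiInterp, h, hK.integral_stencil hAx hAy]
  exact tsum_mul_bspline_quadratic hx hy c₀ c₁ c₂ c₃ c₄ c₅ z

end Exact

/-- If -λ is the common value in `first`, then `second` gives λ = (1/4 + σ)hᵢ² / ((1/4 + σ)(hᵢ₋₁ +
hᵢ₊₁) + (1/2 - 2σ)hᵢ). The factors of hᵢ₋₁, hᵢ, hᵢ₊₁ are in the ratio 3 : 4 : 3 for σ = 1/20, and
all equal for σ = 1/12. -/
theorem isExact_a {x : ℤ → ℝ} (hx : IsKnots x) : IsExact x (1 / 20) a aBar where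
  first i := by
    have h₁ := hx.step_pos (i - 1)
    have h₂ := hx.step_pos i
    have h₃ := hx.step_pos (i + 1)
    rw [a, aBar]
    field_simp
  second i := by
    have h₁ := hx.step_pos (i - 1)
    have h₂ := hx.step_pos i
    have h₃ := hx.step_pos (i + 1)
    rw [a, aBar]
    field_simp
    ring

theorem isExact_alpha {x : ℤ → ℝ} (hx : IsKnots x) : IsExact x (1 / 12) alpha alphaBar where
  first i := by
    have h₁ := hx.step_pos (i - 1)
    have h₂ := hx.step_pos i
    have h₃ := hx.step_pos (i + 1)
    rw [alpha, alphaBar]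
    field_simp
  second i := by
    have h₁ := hx.step_pos (i - 1)
    have h₂ := hx.step_pos i
    have h₃ := hx.step_pos (i + 1)
    rw [alpha, alphaBar]
    field_simp
    ring

/-! ### Uniform bounds -/

/-- Dropping the neighbouring steps decreases the denominators and leaves 3h² / (h · 4h) = 3/4. -/
theorem abs_a_le {x : ℤ → ℝ} (hx : IsKnots x) (i : ℤ) : |a x i| ≤ 3 / 4 ∧ |aBar x i| ≤ 3 / 4 := by
  have h₁ := hx.step_pos (i - 1)
  have h₂ := hx.step_pos i
  have h₃ := hx.step_pos (i + 1)
  have p₁ := mul_pos h₁ h₂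
  have p₂ := mul_pos h₂ h₃
  have p₃ := mul_pos h₁ h₃
  have p₄ := mul_pos h₁ h₁
  have p₅ := mul_pos h₃ h₃
  constructor
  · rw [a, neg_mul, neg_div, abs_neg, abs_of_nonneg (by positivity), div_le_iff₀ (by positivity)]
    nlinarith
  · rw [aBar, neg_mul, neg_div, abs_neg, abs_of_nonneg (by positivity),
      div_le_iff₀ (by positivity)]
    nlinarith

/-- Dropping the neighbouring steps leaves h² / (h · h) = 1. -/
theorem abs_alpha_le {x : ℤ → ℝ} (hx : IsKnots x) (i : ℤ) :
    |alpha x i| ≤ 1 ∧ |alphaBar x i| ≤ 1 := by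
  have h₁ := hx.step_pos (i - 1)
  have h₂ := hx.step_pos i
  have h₃ := hx.step_pos (i + 1)
  have p₁ := mul_pos h₁ h₂
  have p₂ := mul_pos h₂ h₃
  have p₃ := mul_pos h₁ h₃
  have p₄ := mul_pos h₁ h₁
  have p₅ := mul_pos h₃ h₃
  constructor
  · rw [alpha, neg_div, abs_neg, abs_of_nonneg (by positivity), div_le_iff₀ (by positivity)]
    nlinarith
  · rw [alphaBar, neg_div, abs_neg, abs_of_nonneg (by positivity), div_le_iff₀ (by positivity)]
    nlinarith

section Bound

variable {x y : ℤ → ℝ}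

/-- The weights are integrable with `L¹` norms at most `C`. -/
structure IsBoundedWeight (w : ℤ → ℤ → ℝ × ℝ → ℝ) (C : ℝ) : Prop where
  integrable : ∀ i j, Integrable (w i j)
  integral_abs_le : ∀ i j, ∫ z, |w i j z| ≤ C

/-- Each `K i j` is nonnegative with integral 1, so the L¹ norm is at most the sum of the absolute
values of the coefficients: four outer ones of size `r` and a central one of size `1 + 4 * r`. -/
theorem IsMeanWeight.isBoundedWeight_stencil {σ r : ℝ} {A A' : (ℤ → ℝ) → ℤ → ℝ}
    {K : ℤ → ℤ → ℝ × ℝ → ℝ} (hK : IsMeanWeight x y σ K) (hx : ∀ i, |A x i| ≤ r ∧ |A' x i| ≤ r)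
    (hy : ∀ j, |A y j| ≤ r ∧ |A' y j| ≤ r) :
    IsBoundedWeight (stencil x y A A' K) (1 + 8 * r) := by
  have h : ∀ i j, HasIntegral (K i j) 1 := fun i j => by
    simpa using hK.hasIntegral i j 1 0 0 0 0 0
  have hint : ∀ i j, Integrable (stencil x y A A' K i j) := fun i j =>
    ((((((h (i - 1) j).const_mul (A x i)).add ((h (i + 1) j).const_mul (A' x i))).add
      ((h i j).const_mul (1 - (A x i + A' x i + A y j + A' y j)))).add
        ((h i (j - 1)).const_mul (A y j))).add ((h i (j + 1)).const_mul (A' y j))).integrable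
  refine ⟨hint, fun i j => ?_⟩
  have key := (((((h (i - 1) j).const_mul r).add ((h (i + 1) j).const_mul r)).add
    ((h i j).const_mul (1 + 4 * r))).add ((h i (j - 1)).const_mul r)).add
      ((h i (j + 1)).const_mul r)
  refine (integral_mono (hint i j).abs key.integrable fun z => ?_).trans
    (key.integral_eq.le.trans (by linarith))
  obtain ⟨hx₁, hx₂⟩ := hx i
  obtain ⟨hy₁, hy₂⟩ := hy j
  have hmid : |1 - (A x i + A' x i + A y j + A' y j)| ≤ 1 + 4 * r := by
    rw [abs_le] at *
    constructor <;> linarith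
  have aux : ∀ {c R : ℝ} (k l : ℤ), |c| ≤ R → |c * K k l z| ≤ R * K k l z := by
    intro c R k l hc
    rw [abs_mul, abs_of_nonneg (hK.nonneg k l z)]
    exact mul_le_mul_of_nonneg_right hc (hK.nonneg k l z)
  refine (abs_add_le _ _).trans (add_le_add ((abs_add_le _ _).trans (add_le_add
    ((abs_add_le _ _).trans (add_le_add ((abs_add_le _ _).trans (add_le_add ?_ ?_)) ?_)) ?_)) ?_)
  · exact aux _ _ hx₁
  · exact aux _ _ hx₂
  · exact aux _ _ hmid
  · exact aux _ _ hy₁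
  · exact aux _ _ hy₂

/-- By positivity and the partition of unity, the value is a convex combination of the coefficients.
-/
theorem abs_tsum_mul_bspline_le (hx : IsKnots x) (hy : IsKnots y) {c : ℤ × ℤ → ℝ} {C : ℝ}
    (hc : ∀ ij, |c ij| ≤ C) (z : ℝ × ℝ) :
    |∑' ij : ℤ × ℤ, c ij * bspline x y ij.1 ij.2 z| ≤ C := by
  have h₁ := tsum_mul_bspline hx hy (fun _ => 1) z
  simp only [one_mul, tsum_bspline hx hy] at h₁
  rw [tsum_mul_bspline hx hy]
  refine (Finset.abs_sum_le_sum_abs _ _).trans ?_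
  rw [← mul_one C, h₁, Finset.mul_sum]
  refine Finset.sum_le_sum fun ij _ => ?_
  rw [abs_mul, abs_of_nonneg (bspline_nonneg hx hy _ _ z)]
  exact mul_le_mul_of_nonneg_right (hc ij) (bspline_nonneg hx hy _ _ z)

theorem ae_abs_le_norm (f : Lp ℝ ∞ (volume : Measure (ℝ × ℝ))) : ∀ᵐ v, ‖f v‖ ≤ ‖f‖ := by
  rw [Lp.norm_def, toReal_eLpNorm (Lp.aestronglyMeasurable f)]
  exact ae_le_lpNorm_exponent_top (Lp.memLp f)

variable {w : ℤ → ℤ → ℝ × ℝ → ℝ} {C : ℝ}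

theorem IsBoundedWeight.integrable_mul (hw : IsBoundedWeight w C)
    (f : Lp ℝ ∞ (volume : Measure (ℝ × ℝ))) (i j : ℤ) : Integrable fun v => f v * w i j v :=
  (hw.integrable i j).bdd_mul (Lp.aestronglyMeasurable f) (ae_abs_le_norm f)

theorem IsBoundedWeight.abs_integral_mul_le (hw : IsBoundedWeight w C)
    (f : Lp ℝ ∞ (volume : Measure (ℝ × ℝ))) (i j : ℤ) : |∫ v, f v * w i j v| ≤ C * ‖f‖ := by
  have h : ‖∫ v, f v * w i j v‖ ≤ ∫ v, ‖f‖ * |w i j v| := by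
    refine norm_integral_le_of_norm_le ((hw.integrable i j).abs.const_mul _) ?_
    filter_upwards [ae_abs_le_norm f] with v hv
    rw [norm_mul]
    exact mul_le_mul_of_nonneg_right hv (norm_nonneg _)
  rw [integral_const_mul] at h
  calc _ ≤ ‖f‖ * ∫ v, |w i j v| := h
    _ ≤ ‖f‖ * C := mul_le_mul_of_nonneg_left (hw.integral_abs_le i j) (norm_nonneg _)
    _ = _ := mul_comm _ _

theorem isC1QuadraticSpline_quasiInterp (hx : IsKnots x) (hy : IsKnots y) (f : ℝ × ℝ → ℝ) :
    IsC1QuadraticSpline x y (quasiInterp x y w f) :=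
  isC1QuadraticSpline_tsum hx hy fun i j => ∫ v, f v * w i j v

theorem abs_quasiInterp_le (hx : IsKnots x) (hy : IsKnots y) (hw : IsBoundedWeight w C)
    (f : Lp ℝ ∞ (volume : Measure (ℝ × ℝ))) (z : ℝ × ℝ) : |quasiInterp x y w f z| ≤ C * ‖f‖ :=
  abs_tsum_mul_bspline_le hx hy (fun ij => hw.abs_integral_mul_le f ij.1 ij.2) z

/-- The representative of a sum in `Lp` equals the sum of representatives only almost everywhere;
the integrals do not see the difference. -/
theorem quasiInterp_add (hx : IsKnots x) (hy : IsKnots y) (hw : IsBoundedWeight w C)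
    (f g : Lp ℝ ∞ (volume : Measure (ℝ × ℝ))) (z : ℝ × ℝ) :
    quasiInterp x y w ↑(f + g) z = quasiInterp x y w f z + quasiInterp x y w g z := by
  simp only [quasiInterp]
  rw [tsum_mul_bspline hx hy fun ij => ∫ v, (f + g) v * w ij.1 ij.2 v,
    tsum_mul_bspline hx hy fun ij => ∫ v, f v * w ij.1 ij.2 v,
    tsum_mul_bspline hx hy fun ij => ∫ v, g v * w ij.1 ij.2 v, ← Finset.sum_add_distrib]
  refine Finset.sum_congr rfl fun ij _ => ?_
  rw [← add_mul, ← integral_add (hw.integrable_mul f _ _) (hw.integrable_mul g _ _)]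
  congr 1
  refine integral_congr_ae ?_
  filter_upwards [Lp.coeFn_add f g] with v hv
  rw [hv, Pi.add_apply, add_mul]

theorem quasiInterp_smul (hx : IsKnots x) (hy : IsKnots y) (r : ℝ)
    (f : Lp ℝ ∞ (volume : Measure (ℝ × ℝ))) (z : ℝ × ℝ) :
    quasiInterp x y w ↑(r • f) z = r * quasiInterp x y w f z := by
  simp only [quasiInterp]
  rw [tsum_mul_bspline hx hy fun ij => ∫ v, (r • f) v * w ij.1 ij.2 v,
    tsum_mul_bspline hx hy fun ij => ∫ v, f v * w ij.1 ij.2 v, Finset.mul_sum]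
  refine Finset.sum_congr rfl fun ij _ => ?_
  rw [← mul_assoc, ← integral_const_mul]
  congr 1
  refine integral_congr_ae ?_
  filter_upwards [Lp.coeFn_smul r f] with v hv
  rw [hv, Pi.smul_apply, smul_eq_mul, mul_assoc]

theorem exists_continuousLinearMap (hx : IsKnots x) (hy : IsKnots y) (hw : IsBoundedWeight w C)
    (hC : 0 ≤ C) :
    ∃ T : Lp ℝ ∞ (volume : Measure (ℝ × ℝ)) →L[ℝ] ((ℝ × ℝ) →ᵇ ℝ),
      (∀ (f : Lp ℝ ∞ (volume : Measure (ℝ × ℝ))) (z : ℝ × ℝ), T f z = quasiInterp x y w f z) ∧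
      ‖T‖ ≤ C := by
  let L : Lp ℝ ∞ (volume : Measure (ℝ × ℝ)) →ₗ[ℝ] ((ℝ × ℝ) →ᵇ ℝ) :=
    { toFun := fun f => BoundedContinuousFunction.ofNormedAddCommGroup (quasiInterp x y w f)
        (isC1QuadraticSpline_quasiInterp hx hy f).1.continuous (C * ‖f‖)
        (abs_quasiInterp_le hx hy hw f)
      map_add' := fun f g => by
        ext z
        exact quasiInterp_add hx hy hw f g z
      map_smul' := fun r f => by
        ext z
        exact quasiInterp_smul hx hy r f z }
  have hL : ∀ f, ‖L f‖ ≤ C * ‖f‖ := fun f =>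
    BoundedContinuousFunction.norm_ofNormedAddCommGroup_le _ (by positivity)
      (abs_quasiInterp_le hx hy hw f)
  exact ⟨L.mkContinuous C hL, fun f z => rfl, L.mkContinuous_norm_le hC hL⟩

end Bound

end CrissCross

theorem mainTheorem3 (x y : ℤ → ℝ)
    (hx : StrictMono x) (hx_top : Tendsto x atTop atTop) (hx_bot : Tendsto x atBot atBot)
    (hy : StrictMono y) (hy_top : Tendsto y atTop atTop) (hy_bot : Tendsto y atBot atBot) :
    -- the `B i j` are `C¹` quadratic splines with octagonal support and form a partition of unity
    ((∀ i j : ℤ, CrissCross.IsC1QuadraticSpline x y (CrissCross.bspline x y i j) ∧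
        tsupport (CrissCross.bspline x y i j) = CrissCross.octagon x y i j) ∧
      ∀ z : ℝ × ℝ, ∑' ij : ℤ × ℤ, CrissCross.bspline x y ij.1 ij.2 z = 1) ∧
    -- `T₂` and `G₂` take their values in the space of `C¹` quadratic splines
    (∀ f : ℝ × ℝ → ℝ, LocallyIntegrable f →
      CrissCross.IsC1QuadraticSpline x y (CrissCross.T2 x y f) ∧
      CrissCross.IsC1QuadraticSpline x y (CrissCross.G2 x y f)) ∧
    -- both are exact on the bivariate polynomials of total degree at most `2`
    (∀ p : MvPolynomial (Fin 2) ℝ, p.totalDegree ≤ 2 →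
      CrissCross.T2 x y (CrissCross.polyFun p) = CrissCross.polyFun p ∧
      CrissCross.G2 x y (CrissCross.polyFun p) = CrissCross.polyFun p) ∧
    -- both are bounded operators for the uniform norm, with norms at most `7` and `9`
    (∃ T : Lp ℝ ∞ (volume : Measure (ℝ × ℝ)) →L[ℝ] ((ℝ × ℝ) →ᵇ ℝ),
      (∀ (f : Lp ℝ ∞ (volume : Measure (ℝ × ℝ))) (z : ℝ × ℝ), T f z = CrissCross.T2 x y f z) ∧
      ‖T‖ ≤ 7) ∧
    (∃ G : Lp ℝ ∞ (volume : Measure (ℝ × ℝ)) →L[ℝ] ((ℝ × ℝ) →ᵇ ℝ),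
      (∀ (f : Lp ℝ ∞ (volume : Measure (ℝ × ℝ))) (z : ℝ × ℝ), G f z = CrissCross.G2 x y f z) ∧
      ‖G‖ ≤ 9) := by
  have kx : CrissCross.IsKnots x := ⟨hx, hx_top, hx_bot⟩
  have ky : CrissCross.IsKnots y := ⟨hy, hy_top, hy_bot⟩
  have hP := CrissCross.isMeanWeight_pyramidN kx ky
  have hK := CrissCross.isMeanWeight_chiN kx ky
  have bT := hP.isBoundedWeight_stencil (CrissCross.abs_a_le kx) (CrissCross.abs_a_le ky)
  have bG := hK.isBoundedWeight_stencil (CrissCross.abs_alpha_le kx) (CrissCross.abs_alpha_le ky)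
  -- The bounds become 1 + 8 · 3/4 = 7 and 1 + 8 · 1 = 9.
  norm_num only at bT bG
  rw [CrissCross.T2_eq, CrissCross.G2_eq]
  refine ⟨⟨fun i j => ⟨CrissCross.isC1QuadraticSpline_bspline kx ky i j,
    CrissCross.tsupport_bspline kx ky i j⟩, CrissCross.tsum_bspline kx ky⟩, fun f _ =>
    ⟨CrissCross.isC1QuadraticSpline_quasiInterp kx ky f,
      CrissCross.isC1QuadraticSpline_quasiInterp kx ky f⟩, fun p hp =>
    ⟨CrissCross.quasiInterp_polyFun kx ky hP (CrissCross.isExact_a kx) (CrissCross.isExact_a ky) hp,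
      CrissCross.quasiInterp_polyFun kx ky hK (CrissCross.isExact_alpha kx)
        (CrissCross.isExact_alpha ky) hp⟩,
    CrissCross.exists_continuousLinearMap kx ky bT (by norm_num),
    CrissCross.exists_continuousLinearMap kx ky bG (by norm_num)⟩
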